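/- Let $\mathbb F$ be a field and let $d,n,k_1,\dots,k_d$ be positive integers with $k_1+\dots+k_d=n$. A $k$-plane is a $k$-dimensional affine subspace of $\mathbb F^n$; for a $k$-plane $\pi$ let $e(\pi)\in\mathrm{Gr}(k,\mathbb F^n)$ be its translate through the origin, where $\mathrm{Gr}(k,\mathbb F^n)$ is the set of $k$-dimensional linear subspaces of $\mathbb F^n$. For $p\in\mathbb F^n$ and $k_j$-planes $\pi_j$ put $\delta(p,\pi_1,\dots,\pi_d)=1$ if $p\in\pi_1\cap\dots\cap\pi_d$ and $e(\pi_1),\dots,e(\pi_d)$ together span $\mathbb F^n$, and $\delta(p,\pi_1,\dots,\pi_d)=0$ otherwise. **Theorem (Multijoint Factorisation Theorem).** For every $n$ there is a constant $C=C(n)$, depending only on $n$, such that the following holds for all $\mathbb F,d,k_1,\dots,k_d$ as above. Let $\Pi_j$ be a (finite or infinite) set of $k_j$-planes in $\mathbb F^n$ for $1\le j\le d$, and let $$J=\{p\in\mathbb F^n:\ \delta(p,\pi_1,\dots,\pi_d)=1\text{ for some }(\pi_1,\dots,\pi_d)\in\Pi_1\times\dots\times\Pi_d\}$$ be their set of multijoints.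 (i) For every finitely supported $S:J\to\mathbb R_{\ge0}$ with $\|S\|_d=\big(\sum_{p\in J}S(p)^d\big)^{1/d}=1$ there are functions $s_{\kappa}:J\times\mathrm{Gr}(\kappa,\mathbb F^n)\to\mathbb R_{\ge0}$, one for each $\kappa\in\{k_1,\dots,k_d\}$, such that $$\delta(p,\pi_1,\dots,\pi_d)\,S(p)^d\le C\prod_{j=1}^d s_{k_j}(p,e(\pi_j))\qquad\text{for all }p\in J,\ (\pi_1,\dots,\pi_d)\in\Pi_1\times\dots\times\Pi_d,$$ and $$\sum_{p\in\pi_j\cap J}s_{k_j}(p,e(\pi_j))=1\qquad\text{for all }1\le j\le d\text{ and all }\pi_j\in\Pi_j\text{ with }\pi_j\cap J\ne\emptyset .$$ (ii) (Multijoint inequality.) If $d\ge2$, then for all $f_j:\Pi_j\to\mathbb R_{\ge0}$, $1\le j\le d$, $$\sum_{p\in\mathbb F^n}\Big(\sum_{\pi_1\in\Pi_1}\cdots\sum_{\pi_d\in\Pi_d}\delta(p,\pi_1,\dots,\pi_d)f_1(\pi_1)\cdots f_d(\pi_d)\Big)^{\frac1{d-1}}\le C\prod_{j=1}^d\Big(\sum_{\pi_j\in\Pi_j}f_j(\pi_j)\Big)^{\frac1{d-1}},$$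 where sums take values in $[0,\infty]$ and $0\cdot\infty=0$. -/

import Mathlib

open scoped NNReal ENNReal

/-- The Grassmannian `Gr(k, 𝔽ⁿ)`: the `k`-dimensional linear subspaces of `𝔽ⁿ`. -/
def Gr (𝔽 : Type*) [Field 𝔽] (k n : ℕ) : Type _ :=
  {V : Submodule 𝔽 (Fin n → 𝔽) // Module.finrank 𝔽 V = k}

/-- An affine `k`-plane in `𝔽ⁿ`. -/
@[ext]
structure KPlane (𝔽 : Type*) [Field 𝔽] (k n : ℕ) where
  carrier : AffineSubspace 𝔽 (Fin n → 𝔽)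
  nonempty : (carrier : Set (Fin n → 𝔽)).Nonempty
  finrank_direction : Module.finrank 𝔽 carrier.direction = k

/-- `e(π)`: the translate of the plane `π` that contains the origin. -/
def KPlane.e {𝔽 : Type*} [Field 𝔽] {k n : ℕ} (π : KPlane 𝔽 k n) : Gr 𝔽 k n :=
  ⟨π.carrier.direction, π.finrank_direction⟩

open Classical in
/-- The discrete wedge product `V₁ ∧ ⋯ ∧ V_d`: it is `1` if the subspaces `V_j` together span `𝔽ⁿ`,
and `0` otherwise. (Any `k_j` linearly independent directions in the `k_j`-dimensional space `V_j`
span `V_j`, so this is the wedge product of any such choice of directions.) -/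
noncomputable def discreteWedge {𝔽 : Type*} [Field 𝔽] {n d : ℕ} {k : Fin d → ℕ}
    (V : ∀ j, Gr 𝔽 (k j) n) : ℝ≥0 :=
  if (⨆ j, (V j).1) = ⊤ then 1 else 0

/-- The multijoint kernel `δ(p, π₁, …, π_d) = (∏ j, χ_{π_j}(p)) (e(π₁) ∧ ⋯ ∧ e(π_d))`. -/
noncomputable def multijointKernel {𝔽 : Type*} [Field 𝔽] {n d : ℕ} {k : Fin d → ℕ}
    (p : Fin n → 𝔽) (π : ∀ j, KPlane 𝔽 (k j) n) : ℝ≥0 :=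
  (∏ j, Set.indicator ((π j).carrier : Set (Fin n → 𝔽)) (fun _ => (1 : ℝ≥0)) p) *
    discreteWedge fun j => (π j).e

/-- The set `J` of multijoints of the sets of planes `P 1, …, P d`. -/
def multijoints {𝔽 : Type*} [Field 𝔽] {n d : ℕ} {k : Fin d → ℕ}
    (P : ∀ j, Set (KPlane 𝔽 (k j) n)) : Set (Fin n → 𝔽) :=
  {p | ∃ π : ∀ j, KPlane 𝔽 (k j) n, (∀ j, π j ∈ P j) ∧ multijointKernel p π = 1}

/-- The multijoint operator `T[f₁, …, f_d](p) = ∑ δ(p, π₁, …, π_d) f₁(π₁) ⋯ f_d(π_d)`, the sum being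
over all tuples with `π_j ∈ P j`. It takes values in `[0, ∞]`, as the sets `P j` may be infinite. -/
noncomputable def multijointOperator {𝔽 : Type*} [Field 𝔽] {n d : ℕ} {k : Fin d → ℕ}
    (P : ∀ j, Set (KPlane 𝔽 (k j) n)) (f : ∀ j, P j → ℝ≥0) (p : Fin n → 𝔽) : ℝ≥0∞ :=
  ∑' π : ∀ j, P j, ((multijointKernel p (fun j => (π j).1) * ∏ j, f j (π j) : ℝ≥0) : ℝ≥0∞)

/-- The norm `‖S‖_d = (∑ S(p)^d)^(1/d)`, for finitely supported `S`. -/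
noncomputable def dNorm {X : Type*} (d : ℕ) (S : X → ℝ≥0) : ℝ≥0 :=
  (∑' p, S p ^ d) ^ (1 / (d : ℝ))

/-! ### Counting the vanishing conditions that points impose in turn -/

section JetSpaces

open Module

variable {F R : Type*} [Field F] [CommRing R] [Algebra F R]

/-! The functions `s` come from counting vanishing conditions. List the points of the support of S.
On a k-plane, take the polynomials of degree at most N and ask for vanishing of growing order at the
listed points, round after round, point q entering only at time `a q`. The share of a point is the
number of its conditions not implied by earlier ones. The shares on a plane that meets the list add
up to the full dimension C(k+N, N), so after division by it they sum to 1; and a share depends only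
on the point and the direction of the plane, as (i) demands.

The pointwise bound rests on `polyShare_sum_le`: if directions form a direct sum, the share on the
sum is at most the product of the shares. The shares in the whole space add up to C(n+N, N), while
the product of the C(k_j+N, N) is at most n! C(n+N, N). Hence, whatever spanning tuple of directions
is picked at each point, the products of relative shares sum to at least 1/n!. This survives if only
a group of points is summed over, provided all others enter more than N rounds later.

The delays serve to redistribute this total (`exists_delay`). Lowering the delay of a point cannot
raise the values of the others, and raises its own by O(1/N) at most, because multiplication by a
linear form trades one order of vanishing for one degree. A configuration of minimal total delay
then gives every point p, for all spanning tuples at once, a product of at least S(p)^d / (2 n!), so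
C = 2 n! works.

Part (ii) follows by duality: with T the multijoint operator, apply (i) to S^d proportional to
T^(1/(d-1)), then use Hölder and the normalisation of `s`. -/

theorem finrank_sub_finrank_inf_le {M M' : Type*} [AddCommGroup M] [Module F M] [AddCommGroup M']
    [Module F M'] {A K : Submodule F M} {A' K' : Submodule F M'}
    [FiniteDimensional F A] [FiniteDimensional F A'] (f : M →ₗ[F] M')
    (hA : ∀ x ∈ A, f x ∈ A') (hK : ∀ x ∈ A, f x ∈ K' → x ∈ K) :
    finrank F A - finrank F (A ⊓ K : Submodule F M) ≤
      finrank F A' - finrank F (A' ⊓ K' : Submodule F M') := by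
  -- By `hK` the kernel of the induced map from `A` to `A'` modulo `K'` lies in `A ⊓ K`, so
  -- rank-nullity compares the codimensions.
  let g : A →ₗ[F] A' ⧸ K'.comap A'.subtype := (Submodule.mkQ _) ∘ₗ f.restrict hA
  have h1 := LinearMap.finrank_range_add_finrank_ker g
  have h2 : finrank F (LinearMap.ker g) ≤ finrank F (A ⊓ K : Submodule F M) := by
    rw [← Submodule.finrank_map_subtype_eq A (LinearMap.ker g)]
    have : FiniteDimensional F (A ⊓ K : Submodule F M) := Submodule.finiteDimensional_inf_left A K
    apply Submodule.finrank_mono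
    rintro _ ⟨x, hx, rfl⟩
    refine ⟨x.2, hK _ x.2 ?_⟩
    simpa [g, Submodule.Quotient.mk_eq_zero] using hx
  have h3 := Submodule.finrank_le (LinearMap.range g)
  have h4 := Submodule.finrank_quotient_add_finrank (K'.comap A'.subtype)
  have h5 : finrank F (K'.comap A'.subtype) = finrank F (A' ⊓ K' : Submodule F M') := by
    rw [← Submodule.finrank_map_subtype_eq A', Submodule.map_comap_subtype]
  omega

variable {m : ℕ}

/-- The elements of `L` whose order of vanishing along each ideal `𝔪 q` is at least the order
requested at stage `(s, i)`, when the point `q` starts being processed at time `a q`. -/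
def jetSpace (L : Submodule F R) (𝔪 : Fin m → Ideal R) (a : Fin m → ℕ) (s i : ℕ) :
    Submodule F R :=
  L ⊓ ⨅ q : Fin m, ((𝔪 q ^ ((s + if (q : ℕ) < i then 1 else 0) - a q)).restrictScalars F)

theorem mem_jetSpace {L : Submodule F R} {𝔪 : Fin m → Ideal R} {a : Fin m → ℕ} {s i : ℕ} {g : R} :
    g ∈ jetSpace L 𝔪 a s i ↔
      g ∈ L ∧ ∀ q : Fin m, g ∈ 𝔪 q ^ ((s + if (q : ℕ) < i then 1 else 0) - a q) := by
  simp [jetSpace]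

theorem jetSpace_succ (L : Submodule F R) (𝔪 : Fin m → Ideal R) (a : Fin m → ℕ) (s : ℕ)
    (p : Fin m) : jetSpace L 𝔪 a s (p + 1) =
      jetSpace L 𝔪 a s p ⊓ (𝔪 p ^ (s + 1 - a p)).restrictScalars F := by
  ext g
  simp only [mem_jetSpace, Submodule.mem_inf, Submodule.restrictScalars_mem]
  constructor
  · rintro ⟨h1, h2⟩
    refine ⟨⟨h1, fun q => Ideal.pow_le_pow_right ?_ (h2 q)⟩, by simpa using h2 p⟩
    split_ifs <;> omega
  · rintro ⟨⟨h1, h2⟩, h3⟩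
    refine ⟨h1, fun q => ?_⟩
    by_cases hq : q = p
    · subst hq; simpa using h3
    · have : (q : ℕ) ≠ p := fun h => hq (Fin.ext h)
      have h := h2 q
      have e : ((q : ℕ) < p + 1) = ((q : ℕ) < p) := by rw [eq_iff_iff]; omega
      simpa only [e] using h

theorem jetSpace_zero (L : Submodule F R) (𝔪 : Fin m → Ideal R) (a : Fin m → ℕ) :
    jetSpace L 𝔪 a 0 0 = L := by
  ext g; simp [mem_jetSpace]

theorem jetSpace_last (L : Submodule F R) (𝔪 : Fin m → Ideal R) (a : Fin m → ℕ) (s : ℕ) :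
    jetSpace L 𝔪 a s m = jetSpace L 𝔪 a (s + 1) 0 := by
  ext g; simp [mem_jetSpace]

theorem jetSpace_le (L : Submodule F R) (𝔪 : Fin m → Ideal R) (a : Fin m → ℕ) (s i : ℕ) :
    jetSpace L 𝔪 a s i ≤ L := inf_le_left

instance (L : Submodule F R) [FiniteDimensional F L] (𝔪 : Fin m → Ideal R) (a : Fin m → ℕ)
    (s i : ℕ) : FiniteDimensional F (jetSpace L 𝔪 a s i) :=
  Submodule.finiteDimensional_inf_left _ _

/-- The number of new conditions imposed on `L` when the point `p` is processed at time `s`. -/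
noncomputable def jetDrop (L : Submodule F R) (𝔪 : Fin m → Ideal R) (a : Fin m → ℕ) (s : ℕ)
    (p : Fin m) : ℕ :=
  finrank F (jetSpace L 𝔪 a s p) - finrank F (jetSpace L 𝔪 a s (p + 1))

/-- The number of conditions imposed on `L` by the point `p` up to time `S`. -/
noncomputable def share (L : Submodule F R) (𝔪 : Fin m → Ideal R) (a : Fin m → ℕ) (S : ℕ)
    (p : Fin m) : ℕ :=
  ∑ s ∈ Finset.range S, jetDrop L 𝔪 a s p

theorem jetDrop_add (L : Submodule F R) [FiniteDimensional F L] (𝔪 : Fin m → Ideal R)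
    (a : Fin m → ℕ) (s : ℕ) (p : Fin m) :
    jetDrop L 𝔪 a s p + finrank F (jetSpace L 𝔪 a s (p + 1)) = finrank F (jetSpace L 𝔪 a s p) := by
  apply Nat.sub_add_cancel
  apply Submodule.finrank_mono
  rw [jetSpace_succ]; exact inf_le_left

theorem sum_jetDrop (L : Submodule F R) [FiniteDimensional F L] (𝔪 : Fin m → Ideal R)
    (a : Fin m → ℕ) (s : ℕ) :
    ∑ p, jetDrop L 𝔪 a s p + finrank F (jetSpace L 𝔪 a (s + 1) 0) =
      finrank F (jetSpace L 𝔪 a s 0) := by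
  have key : ∀ i ≤ m, ∑ j ∈ Finset.range i, (finrank F (jetSpace L 𝔪 a s j) -
      finrank F (jetSpace L 𝔪 a s (j + 1))) + finrank F (jetSpace L 𝔪 a s i) =
        finrank F (jetSpace L 𝔪 a s 0) := by
    intro i
    induction i with
    | zero => simp
    | succ i ih =>
      intro hi
      have h := jetDrop_add L 𝔪 a s ⟨i, hi⟩
      have := ih (by omega)
      simp only [jetDrop] at h
      rw [Finset.sum_range_succ]; omega
  have := key m le_rfl
  rw [jetSpace_last, Finset.sum_range] at this
  exact this

/-- The drops telescope along the chain of jet spaces, from `L` down to `⊥` at time `S`. -/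
theorem sum_share (L : Submodule F R) [FiniteDimensional F L] (𝔪 : Fin m → Ideal R)
    (a : Fin m → ℕ) (S : ℕ) (hS : jetSpace L 𝔪 a S 0 = ⊥) :
    ∑ p, share L 𝔪 a S p = finrank F L := by
  have key : ∀ S, ∑ p, share L 𝔪 a S p + finrank F (jetSpace L 𝔪 a S 0) = finrank F L := by
    intro S
    induction S with
    | zero => rw [jetSpace_zero]; simp [share]
    | succ S ih =>
      have h := sum_jetDrop L 𝔪 a S
      simp only [share, Finset.sum_range_succ, Finset.sum_add_distrib] at ih ⊢
      omega
  have := key S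
  rw [hS] at this
  simpa using this

theorem jetDrop_eq_finrank_sub (L : Submodule F R) (𝔪 : Fin m → Ideal R)
    (a : Fin m → ℕ) (s : ℕ) (p : Fin m) :
    jetDrop L 𝔪 a s p = finrank F (jetSpace L 𝔪 a s p) - finrank F
      (jetSpace L 𝔪 a s p ⊓ (𝔪 p ^ (s + 1 - a p)).restrictScalars F : Submodule F R) := by
  rw [jetDrop, jetSpace_succ]

theorem jetDrop_eq_zero_of_lt (L : Submodule F R) (𝔪 : Fin m → Ideal R)
    (a : Fin m → ℕ) (s : ℕ) (p : Fin m) (h : s < a p) : jetDrop L 𝔪 a s p = 0 := by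
  rw [jetDrop_eq_finrank_sub, Nat.sub_eq_zero_of_le h, pow_zero, Ideal.one_eq_top,
    Submodule.restrictScalars_top, inf_top_eq, Nat.sub_self]

theorem jetDrop_eq_zero_of_eq_top (L : Submodule F R) (𝔪 : Fin m → Ideal R)
    (a : Fin m → ℕ) (s : ℕ) (p : Fin m) (h : 𝔪 p = ⊤) : jetDrop L 𝔪 a s p = 0 := by
  rw [jetDrop_eq_finrank_sub, h, Ideal.top_pow, Submodule.restrictScalars_top, inf_top_eq,
    Nat.sub_self]

theorem share_eq_zero_of_eq_top (L : Submodule F R) (𝔪 : Fin m → Ideal R)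
    (a : Fin m → ℕ) (S : ℕ) (p : Fin m) (h : 𝔪 p = ⊤) : share L 𝔪 a S p = 0 :=
  Finset.sum_eq_zero fun s _ => jetDrop_eq_zero_of_eq_top L 𝔪 a s p h

theorem jetDrop_eq_zero_of_jetSpace_eq_bot (L : Submodule F R) (𝔪 : Fin m → Ideal R)
    (a : Fin m → ℕ) (s : ℕ) (p : Fin m) (h : jetSpace L 𝔪 a s p = ⊥) :
    jetDrop L 𝔪 a s p = 0 := by
  rw [jetDrop, h, finrank_bot, Nat.zero_sub]

theorem share_le_of_le (L : Submodule F R) [FiniteDimensional F L] (𝔪 : Fin m → Ideal R)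
    (a : Fin m → ℕ) (S : ℕ) (p : Fin m) (hS : jetSpace L 𝔪 a S 0 = ⊥) :
    share L 𝔪 a S p ≤ finrank F L := by
  rw [← sum_share L 𝔪 a S hS]
  exact Finset.single_le_sum (f := fun p => share L 𝔪 a S p) (fun _ _ => Nat.zero_le _)
    (Finset.mem_univ p)

/-- Conditions independent on a subspace remain independent on a larger space. -/
theorem share_mono_left {L L' : Submodule F R} [FiniteDimensional F L] [FiniteDimensional F L']
    (h : L ≤ L') (𝔪 : Fin m → Ideal R) (a : Fin m → ℕ) (S : ℕ) (p : Fin m) :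
    share L 𝔪 a S p ≤ share L' 𝔪 a S p := by
  refine Finset.sum_le_sum fun s _ => ?_
  rw [jetDrop_eq_finrank_sub, jetDrop_eq_finrank_sub]
  refine finrank_sub_finrank_inf_le LinearMap.id (fun x hx => ?_) fun x _ h => h
  rw [mem_jetSpace] at hx
  exact mem_jetSpace.2 ⟨h hx.1, hx.2⟩

/-- Delaying the other points removes conditions imposed before `p`, so the conditions at `p` act on
a larger space. -/
theorem share_mono_delay (L : Submodule F R) [FiniteDimensional F L] (𝔪 : Fin m → Ideal R)
    {a a' : Fin m → ℕ} (S : ℕ) (p : Fin m) (h : ∀ q, a q ≤ a' q) (hp : a p = a' p) :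
    share L 𝔪 a S p ≤ share L 𝔪 a' S p := by
  refine Finset.sum_le_sum fun s _ => ?_
  rw [jetDrop_eq_finrank_sub, jetDrop_eq_finrank_sub, hp]
  refine finrank_sub_finrank_inf_le LinearMap.id (fun x hx => ?_) fun x _ h => h
  rw [mem_jetSpace] at hx
  refine mem_jetSpace.2 ⟨hx.1, fun q => Ideal.pow_le_pow_right ?_ (hx.2 q)⟩
  have := h q
  omega

/-- An element outside a maximal ideal is invertible modulo it, so multiplication by it cannot raise
the order of vanishing. -/
theorem mem_pow_of_mul_mem_pow {I : Ideal R} (hI : I.IsMaximal) {x g : R} (hx : x ∉ I) {k : ℕ}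
    (h : x * g ∈ I ^ k) : g ∈ I ^ k := by
  induction k with
  | zero => simp
  | succ k ih =>
    have hg := ih (Ideal.pow_le_pow_right (Nat.le_succ k) h)
    obtain ⟨y, i, hi, hy⟩ := hI.exists_inv hx
    have : g = y * (x * g) + i * g := by
      rw [← mul_assoc, ← add_mul, hy, one_mul]
    rw [this]
    refine Ideal.add_mem _ (Ideal.mul_mem_left _ _ h) ?_
    rw [pow_succ']
    exact Ideal.mul_mem_mul hi hg

/-- Processing the point `p` one step earlier costs another point at most the passage from `L'`
to `L`. -/
theorem share_le_share_of_mul {L L' : Submodule F R} [FiniteDimensional F L]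
    [FiniteDimensional F L'] (𝔪 : Fin m → Ideal R) {a a' : Fin m → ℕ} (S : ℕ) {p q : Fin m}
    (hpq : p ≠ q) (ha : ∀ q, q ≠ p → a' q = a q) (hap : a p ≤ a' p + 1) (ℓ : R)
    (hℓp : ℓ ∈ 𝔪 p) (hL : ∀ g ∈ L', ℓ * g ∈ L)
    (hq : 𝔪 q = ⊤ ∨ (𝔪 q).IsMaximal ∧ ℓ ∉ 𝔪 q) :
    share L' 𝔪 a S q ≤ share L 𝔪 a' S q := by
  obtain hq | ⟨hq, hℓq⟩ := hq
  · simp [share_eq_zero_of_eq_top _ _ _ _ _ hq]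
  refine Finset.sum_le_sum fun s _ => ?_
  rw [jetDrop_eq_finrank_sub, jetDrop_eq_finrank_sub, ha q hpq.symm]
  -- The factor `ℓ` supplies the one order that may be missing at `p`, and does not change the order
  -- at `q`, where it is a unit modulo `𝔪 q`.
  refine finrank_sub_finrank_inf_le (LinearMap.mulLeft F ℓ) (fun x hx => ?_) fun x _ h => ?_
  · rw [mem_jetSpace] at hx
    refine mem_jetSpace.2 ⟨hL _ hx.1, fun r => ?_⟩
    simp only [LinearMap.mulLeft_apply]
    by_cases hr : r = p
    · subst hr
      have e : (s + if (r : ℕ) < q then 1 else 0) - a' r ≤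
          (s + if (r : ℕ) < q then 1 else 0) - a r + 1 := by omega
      refine Ideal.pow_le_pow_right e ?_
      rw [pow_succ']
      exact Ideal.mul_mem_mul hℓp (hx.2 r)
    · rw [ha r hr]
      exact Ideal.mul_mem_left _ _ (hx.2 r)
  · exact mem_pow_of_mul_mem_pow hq hℓq h

/-- The share of a point varies slowly with its own delay. -/
theorem share_le_add_of_mul {L L' : Submodule F R} [FiniteDimensional F L]
    [FiniteDimensional F L'] (hLL : L' ≤ L) (𝔪 : Fin m → Ideal R) {a a' : Fin m → ℕ} (S : ℕ)
    (p : Fin m) (ha : ∀ q, q ≠ p → a' q = a q) (hap : a p ≤ a' p + 1)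
    (hS : jetSpace L 𝔪 a S 0 = ⊥) (hS' : jetSpace L 𝔪 a' S 0 = ⊥)
    (hS'' : jetSpace L' 𝔪 a S 0 = ⊥)
    (hℓ : ∀ q, q ≠ p → ∃ ℓ : R, ℓ ∈ 𝔪 p ∧ (∀ g ∈ L', ℓ * g ∈ L) ∧
      (𝔪 q = ⊤ ∨ (𝔪 q).IsMaximal ∧ ℓ ∉ 𝔪 q)) :
    share L 𝔪 a' S p + finrank F L' ≤ share L 𝔪 a S p + finrank F L := by
  -- Conservation: under `a'` the other points keep in `L` at least what they had in `L'` under `a`,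
  -- so the share of `p` can grow by at most `finrank L - finrank L'`.
  have h1 := sum_share L 𝔪 a' S hS'
  have h2 := sum_share L 𝔪 a S hS
  have h3 := sum_share L' 𝔪 a S hS''
  rw [← Finset.add_sum_erase _ _ (Finset.mem_univ p)] at h1 h3
  have h4 := share_mono_left hLL 𝔪 a S p
  have h5 : ∑ q ∈ Finset.univ.erase p, share L' 𝔪 a S q ≤
      ∑ q ∈ Finset.univ.erase p, share L 𝔪 a' S q := by
    refine Finset.sum_le_sum fun q hq => ?_
    have hqp := Finset.ne_of_mem_erase hq
    obtain ⟨ℓ, h1, h2, h3⟩ := hℓ q hqp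
    exact share_le_share_of_mul 𝔪 S hqp.symm ha hap ℓ h1 h2 h3
  omega

end JetSpaces

/-! ### Shares of points among polynomials on a parametrised plane -/

section FiberIdeals

open Module MvPolynomial

variable {F : Type*} [Field F] {ι ι' : Type*} {E : Type*}

/-- The ideal of the polynomials vanishing on the fibre of `φ` over `x`. -/
noncomputable def fiberIdeal (φ : (ι → F) → E) (x : E) : Ideal (MvPolynomial ι F) :=
  ⨅ y : {y // φ y = x}, RingHom.ker (eval y.1)

theorem mem_fiberIdeal {φ : (ι → F) → E} {x : E} {g : MvPolynomial ι F} :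
    g ∈ fiberIdeal φ x ↔ ∀ y, φ y = x → eval y g = 0 := by
  simp [fiberIdeal, RingHom.mem_ker]

/-- Points off the plane get the unit ideal, hence no share, so a single list of points and delays
serves all planes. -/
theorem fiberIdeal_eq_top {φ : (ι → F) → E} {x : E} (h : ∀ y, φ y ≠ x) : fiberIdeal φ x = ⊤ := by
  ext g; simp [mem_fiberIdeal, h]

theorem fiberIdeal_eq_ker {φ : (ι → F) → E} (hφ : Function.Injective φ) (y : ι → F) :
    fiberIdeal φ (φ y) = RingHom.ker (eval y) := by
  ext g
  rw [mem_fiberIdeal, RingHom.mem_ker]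
  exact ⟨fun h => h y rfl, fun h z hz => by rwa [hφ hz]⟩

theorem isMaximal_ker_eval (y : ι → F) : (RingHom.ker (eval y)).IsMaximal :=
  RingHom.ker_isMaximal_of_surjective _ fun c => ⟨C c, by simp⟩

theorem ker_eval_zero : RingHom.ker (eval (0 : ι → F)) = idealOfVars ι F := by
  ext g
  rw [RingHom.mem_ker, ← pow_one (idealOfVars ι F), mem_pow_idealOfVars_iff', eval_zero]
  simp [Finsupp.degree_eq_zero_iff, constantCoeff_eq]

theorem map_mem_pow_of_le_comap {A B : Type*} [CommRing A] [CommRing B] {I : Ideal A} {J : Ideal B}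
    (f : A →+* B) (h : ∀ x ∈ I, f x ∈ J) {k : ℕ} {x : A} (hx : x ∈ I ^ k) : f x ∈ J ^ k := by
  have h1 : I.map f ≤ J := Ideal.map_le_iff_le_comap.2 h
  have h2 := Ideal.mem_map_of_mem f hx
  rw [Ideal.map_pow] at h2
  exact Ideal.pow_right_mono h1 k h2

/-- Substitution of an affine map in the variables. -/
noncomputable def affineSubst [Fintype ι'] (M : Matrix ι ι' F) (c : ι → F) :
    MvPolynomial ι F →ₐ[F] MvPolynomial ι' F :=
  aeval fun i => M.toMvPolynomial i + C (c i)

theorem eval_affineSubst [Fintype ι'] (M : Matrix ι ι' F) (c : ι → F) (y : ι' → F)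
    (g : MvPolynomial ι F) : eval y (affineSubst M c g) = eval (M.mulVec y + c) g := by
  induction g using MvPolynomial.induction_on with
  | C r => simp [affineSubst]
  | add f g hf hg => simp [hf, hg]
  | mul_X f i hf =>
    rw [map_mul, map_mul, hf, map_mul]
    simp [affineSubst, Matrix.toMvPolynomial_eval_eq_apply]

theorem totalDegree_affineSubst_le [Fintype ι'] (M : Matrix ι ι' F) (c : ι → F)
    (g : MvPolynomial ι F) : (affineSubst M c g).totalDegree ≤ g.totalDegree := by
  rw [affineSubst, aeval_def, eval₂_eq]
  refine (totalDegree_finsetSum _ _).trans (Finset.sup_le fun s hs => ?_)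
  refine (totalDegree_mul _ _).trans ?_
  rw [algebraMap_eq, totalDegree_C, zero_add]
  refine (totalDegree_finsetProd _ _).trans (le_trans (Finset.sum_le_sum fun i _ => ?_)
    (le_totalDegree hs))
  refine (totalDegree_pow _ _).trans ?_
  calc s i * _ ≤ s i * 1 := by
        gcongr
        refine (totalDegree_add _ _).trans (max_le (Matrix.toMvPolynomial_totalDegree_le _ _) ?_)
        simp
    _ = s i := mul_one _

theorem affineSubst_affineSubst [Fintype ι] [Fintype ι'] [DecidableEq ι] (M : Matrix ι ι' F)
    (c : ι → F) (M' : Matrix ι' ι F) (c' : ι' → F) (hM : M * M' = 1)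
    (hc : M.mulVec c' + c = 0) (g : MvPolynomial ι F) :
    affineSubst M' c' (affineSubst M c g) = g := by
  suffices h : (affineSubst M' c').comp (affineSubst M c) = AlgHom.id F _ from
    DFunLike.congr_fun h g
  refine MvPolynomial.algHom_ext fun i => ?_
  have h := congrFun hc i
  have h2 : (1 : Matrix ι ι F).toMvPolynomial i = X i := by simp
  simp only [Pi.add_apply, Matrix.mulVec, dotProduct, Pi.zero_apply] at h
  rw [← hM, Matrix.toMvPolynomial_mul] at h2
  rw [AlgHom.comp_apply, AlgHom.id_apply]
  have h3 : ∀ t : ι' → MvPolynomial ι F, aeval t (M.toMvPolynomial i) = ∑ j, C (M i j) * t j := by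
    intro t
    simp [Matrix.toMvPolynomial, ← C_mul_X_eq_monomial, map_sum, algebraMap_eq]
  have h4 : (C (∑ j, M i j * c' j) + C (c i) : MvPolynomial ι F) = 0 := by
    rw [← C_add, h, C_0]
  simp only [affineSubst, aeval_X, map_add, aeval_C, algebraMap_eq]
  rw [h3, ← h2, bind₁, h3]
  simp only [mul_add, Finset.sum_add_distrib, add_assoc]
  rw [map_sum] at h4
  simp only [C_mul] at h4
  rw [h4, add_zero]

/-- After a translation to the origin, vanishing to order `k` kills all monomials of degree below
`k`. -/
theorem eq_zero_of_mem_ker_eval_pow [Fintype ι] {y : ι → F} {k : ℕ} {g : MvPolynomial ι F}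
    (hg : g ∈ RingHom.ker (eval y) ^ k) (hk : g.totalDegree < k) : g = 0 := by
  classical
  have h1 : affineSubst 1 y g ∈ RingHom.ker (eval (0 : ι → F)) ^ k :=
    map_mem_pow_of_le_comap (affineSubst 1 y).toRingHom (fun x hx => by
      rw [RingHom.mem_ker] at hx ⊢
      rw [← hx]
      exact (eval_affineSubst 1 y 0 x).trans (by simp)) hg
  rw [ker_eval_zero, mem_pow_idealOfVars_iff'] at h1
  have h2 : affineSubst (1 : Matrix ι ι F) y g = 0 := by
    ext s
    by_cases hs : s.degree < k
    · simp [h1 s hs]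
    · rw [coeff_zero]
      by_contra h
      have h3 := le_totalDegree (mem_support_iff.2 h)
      have h4 := totalDegree_affineSubst_le (1 : Matrix ι ι F) y g
      rw [Finsupp.degree_apply] at hs
      exact hs (lt_of_le_of_lt (h3.trans h4) hk)
  rw [← affineSubst_affineSubst 1 y 1 (-y) (by simp) (by simp) g, h2, map_zero]

variable {m : ℕ}

/-- The share of the point `x p` among polynomials of degree at most `N` on the image of `φ`. -/
noncomputable def polyShare (φ : (ι → F) → E) (x : Fin m → E) (a : Fin m → ℕ) (N S : ℕ)
    (p : Fin m) : ℕ :=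
  share (restrictTotalDegree ι F N) (fun q => fiberIdeal φ (x q)) a S p

theorem jetSpace_fiberIdeal_eq_bot [Fintype ι] {φ : (ι → F) → E} (hφ : Function.Injective φ)
    {x : Fin m → E} {a : Fin m → ℕ} {N S i : ℕ} {q : Fin m} (hq : ∃ y, φ y = x q)
    (hS : N + 1 + a q ≤ S) :
    jetSpace (restrictTotalDegree ι F N) (fun q => fiberIdeal φ (x q)) a S i = ⊥ := by
  rw [eq_bot_iff]
  intro g hg
  rw [mem_jetSpace, mem_restrictTotalDegree] at hg
  obtain ⟨y, hy⟩ := hq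
  have h := hg.2 q
  rw [← hy, fiberIdeal_eq_ker hφ] at h
  refine eq_zero_of_mem_ker_eval_pow h (lt_of_le_of_lt hg.1 ?_)
  omega

/-- An affine substitution respects the degree bound and the ideals of the points, and is injective
if it has a left inverse. Used in both directions, this makes shares independent of the
parametrisation. -/
theorem finrank_jetSpace_le_of_affine [Fintype ι] [Fintype ι'] [DecidableEq ι]
    {φ : (ι → F) → E} {φ' : (ι' → F) → E} {M : Matrix ι ι' F}
    {c : ι → F} {M' : Matrix ι' ι F} {c' : ι' → F} (hM : M * M' = 1)
    (hc : M.mulVec c' + c = 0) (h : ∀ y, φ' y = φ (M.mulVec y + c))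
    (x : Fin m → E) (a : Fin m → ℕ) (N s i : ℕ) :
    finrank F (jetSpace (restrictTotalDegree ι F N) (fun q => fiberIdeal φ (x q)) a s i) ≤
    finrank F (jetSpace (restrictTotalDegree ι' F N) (fun q => fiberIdeal φ' (x q)) a s i) := by
  have hmem : ∀ g ∈ jetSpace (restrictTotalDegree ι F N) (fun q => fiberIdeal φ (x q)) a s i,
      affineSubst M c g ∈
        jetSpace (restrictTotalDegree ι' F N) (fun q => fiberIdeal φ' (x q)) a s i := by
    intro g hg
    rw [mem_jetSpace, mem_restrictTotalDegree] at hg ⊢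
    refine ⟨(totalDegree_affineSubst_le _ _ _).trans hg.1, fun q => ?_⟩
    refine map_mem_pow_of_le_comap (affineSubst M c).toRingHom (fun f hf => ?_) (hg.2 q)
    rw [mem_fiberIdeal] at hf ⊢
    intro y hy
    have := hf (M.mulVec y + c) (by rw [← h, hy])
    rwa [← eval_affineSubst] at this
  refine LinearMap.finrank_le_finrank_of_injective
    (f := (affineSubst M c).toLinearMap.restrict hmem) fun f g hfg => Subtype.ext ?_
  have h2 : affineSubst M c f.1 = affineSubst M c g.1 := congrArg Subtype.val hfg
  rw [← affineSubst_affineSubst M c M' c' hM hc f.1, h2, affineSubst_affineSubst M c M' c' hM hc]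

theorem polyShare_congr_of_linearEquiv [Fintype ι] [Fintype ι'] {φ : (ι → F) → E}
    {φ' : (ι' → F) → E} (e : (ι' → F) ≃ₗ[F] (ι → F)) (c : ι → F) (h : ∀ y, φ' y = φ (e y + c))
    (x : Fin m → E) (a : Fin m → ℕ) (N S : ℕ) (p : Fin m) :
    polyShare φ x a N S p = polyShare φ' x a N S p := by
  classical
  have h1 : LinearMap.toMatrix' e.toLinearMap * LinearMap.toMatrix' e.symm.toLinearMap = 1 := by
    rw [← LinearMap.toMatrix'_comp]; simp
  have h2 : LinearMap.toMatrix' e.symm.toLinearMap * LinearMap.toMatrix' e.toLinearMap = 1 := by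
    rw [← LinearMap.toMatrix'_comp]; simp
  have key : ∀ s i,
      finrank F (jetSpace (restrictTotalDegree ι F N) (fun q => fiberIdeal φ (x q)) a s i) =
      finrank F (jetSpace (restrictTotalDegree ι' F N) (fun q => fiberIdeal φ' (x q)) a s i) := by
    intro s i
    apply le_antisymm
    · refine finrank_jetSpace_le_of_affine (c := c) (c' := -e.symm c) h1 ?_ (fun y => ?_) x a N s i
      · rw [LinearMap.toMatrix'_mulVec]; simp
      · rw [LinearMap.toMatrix'_mulVec, h]; rfl
    · refine finrank_jetSpace_le_of_affine (c' := c) (c := -e.symm c) h2 ?_ (fun y => ?_) x a N s i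
      · rw [LinearMap.toMatrix'_mulVec]; simp
      · rw [LinearMap.toMatrix'_mulVec, h]; simp
  simp only [polyShare, share, jetDrop, key]

theorem polyShare_congr [Fintype ι] [Fintype ι'] [AddCommGroup E] [Module F E]
    {B : (ι → F) →ₗ[F] E} {B' : (ι' → F) →ₗ[F] E} (hB : Function.Injective B)
    (hB' : Function.Injective B') (hr : LinearMap.range B' = LinearMap.range B) {u u' : E}
    (hu : u' - u ∈ LinearMap.range B) (x : Fin m → E) (a : Fin m → ℕ) (N S : ℕ) (p : Fin m) :
    polyShare (fun y => u + B y) x a N S p = polyShare (fun y => u' + B' y) x a N S p := by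
  obtain ⟨c, hc⟩ := hu
  let e : (ι' → F) ≃ₗ[F] (ι → F) := (LinearEquiv.ofInjective B' hB').trans
    ((LinearEquiv.ofEq _ _ hr).trans (LinearEquiv.ofInjective B hB).symm)
  refine polyShare_congr_of_linearEquiv e c (fun y => ?_) x a N S p
  have : B (e y) = B' y := by
    have h := LinearEquiv.apply_symm_apply (LinearEquiv.ofInjective B hB)
      (LinearEquiv.ofEq _ _ hr (LinearEquiv.ofInjective B' hB' y))
    exact congrArg Subtype.val h
  rw [map_add, this, hc]
  abel

theorem sum_polyShare [Fintype ι] {φ : (ι → F) → E} (hφ : Function.Injective φ)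
    {x : Fin m → E} {a : Fin m → ℕ} {N S : ℕ} {q : Fin m} (hq : ∃ y, φ y = x q)
    (hS : N + 1 + a q ≤ S) :
    ∑ p, polyShare φ x a N S p = finrank F (restrictTotalDegree ι F N) :=
  sum_share _ _ _ _ (jetSpace_fiberIdeal_eq_bot hφ hq hS)

theorem polyShare_eq_zero {φ : (ι → F) → E} {x : Fin m → E} {a : Fin m → ℕ} {N S : ℕ} {p : Fin m}
    (hp : ∀ y, φ y ≠ x p) : polyShare φ x a N S p = 0 :=
  share_eq_zero_of_eq_top _ _ _ _ _ (fiberIdeal_eq_top hp)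

theorem polyShare_mono_delay [Fintype ι] {φ : (ι → F) → E} {x : Fin m → E} {a a' : Fin m → ℕ}
    {N S : ℕ} {p : Fin m} (h : ∀ q, a q ≤ a' q) (hp : a p = a' p) :
    polyShare φ x a N S p ≤ polyShare φ x a' N S p :=
  share_mono_delay _ _ S p h hp

/-- By the time `p` enters, the point `q` alone has forced order of vanishing above the degree, so
no polynomial is left. -/
theorem polyShare_eq_zero_of_late [Fintype ι] {φ : (ι → F) → E} (hφ : Function.Injective φ)
    {x : Fin m → E} {a : Fin m → ℕ} {N S : ℕ} {p q : Fin m} (hq : ∃ y, φ y = x q)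
    (h : N + 1 + a q ≤ a p) : polyShare φ x a N S p = 0 := by
  unfold polyShare share
  refine Finset.sum_eq_zero fun s _ => ?_
  by_cases hs : s < a p
  · exact jetDrop_eq_zero_of_lt _ _ _ _ _ hs
  · exact jetDrop_eq_zero_of_jetSpace_eq_bot _ _ _ _ _
      (jetSpace_fiberIdeal_eq_bot hφ hq (by omega))

theorem polyShare_le_add [Fintype ι] {φ : (ι → F) → E} (hφ : Function.Injective φ)
    {x : Fin m → E} (hx : Function.Injective x) {a a' : Fin m → ℕ} {N S : ℕ} {p : Fin m}
    (hp : ∃ y, φ y = x p) (ha : ∀ q, q ≠ p → a' q = a q) (hap : a p = a' p + 1)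
    (hS : N + 2 + a p ≤ S) :
    polyShare φ x a' (N + 1) S p + finrank F (restrictTotalDegree ι F N) ≤
      polyShare φ x a (N + 1) S p + finrank F (restrictTotalDegree ι F (N + 1)) := by
  have hle : restrictTotalDegree ι F N ≤ restrictTotalDegree ι F (N + 1) := fun g hg => by
    rw [mem_restrictTotalDegree] at hg ⊢; omega
  refine share_le_add_of_mul hle _ S p ha hap.le
    (jetSpace_fiberIdeal_eq_bot hφ hp (by omega)) (jetSpace_fiberIdeal_eq_bot hφ hp (by omega))
    (jetSpace_fiberIdeal_eq_bot hφ hp (by omega)) fun q hq => ?_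
  obtain ⟨y, hy⟩ := hp
  by_cases hqy : ∃ z, φ z = x q
  · obtain ⟨z, hz⟩ := hqy
    have hyz : y ≠ z := by
      rintro rfl; exact hq (hx (hz.symm.trans hy))
    obtain ⟨i, hi⟩ := Function.ne_iff.1 hyz
    -- A coordinate that separates the two points gives a linear form vanishing at `p` but not at
    -- `q`, at the price of one degree.
    refine ⟨X i - C (y i), ?_, fun g hg => ?_, Or.inr ⟨?_, ?_⟩⟩
    · rw [← hy, fiberIdeal_eq_ker hφ, RingHom.mem_ker]; simp
    · rw [mem_restrictTotalDegree] at hg ⊢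
      refine (totalDegree_mul _ _).trans ?_
      have h1 : (X i - C (y i) : MvPolynomial ι F).totalDegree ≤ 1 := by
        refine (totalDegree_sub_C_le _ _).trans ?_
        rw [totalDegree_X]
      omega
    · rw [← hz, fiberIdeal_eq_ker hφ]; exact isMaximal_ker_eval z
    · rw [← hz, fiberIdeal_eq_ker hφ, RingHom.mem_ker]
      simpa [sub_eq_zero] using hi.symm
  · push Not at hqy
    refine ⟨0, Ideal.zero_mem _, fun g _ => by simp, Or.inl (fiberIdeal_eq_top hqy)⟩

theorem polyShare_le_finrank [Fintype ι] {φ : (ι → F) → E} (hφ : Function.Injective φ)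
    {x : Fin m → E} {a : Fin m → ℕ} {N S : ℕ} {p : Fin m} (hS : N + 1 + a p ≤ S) :
    polyShare φ x a N S p ≤ finrank F (restrictTotalDegree ι F N) := by
  by_cases hp : ∃ y, φ y = x p
  · exact share_le_of_le _ _ _ _ _ (jetSpace_fiberIdeal_eq_bot hφ hp hS)
  · push Not at hp
    rw [polyShare_eq_zero hp]; exact Nat.zero_le _

end FiberIdeals

/-! ### The dimension of the polynomials of bounded degree -/

section Dimension

open Module MvPolynomial

variable (F : Type*) [Field F]

theorem finrank_restrictTotalDegree_eq_card (ι : Type*) (N : ℕ) :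
    finrank F (restrictTotalDegree ι F N) = Nat.card {s : ι →₀ ℕ // s.degree ≤ N} := by
  rw [restrictTotalDegree, finrank_eq_nat_card_basis (basisRestrictSupport F _)]
  rfl

theorem card_degree_le (k N : ℕ) :
    Nat.card {s : Fin k →₀ ℕ // s.degree ≤ N} = (k + N).choose N := by
  classical
  have hset : ∀ N, Nat.card {s : Fin k →₀ ℕ // s.degree ≤ N} =
      ((Finset.range (N + 1)).biUnion fun r => Finset.univ.finsuppAntidiag r :
        Finset (Fin k →₀ ℕ)).card := by
    intro N
    refine Nat.subtype_card _ fun s => ?_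
    simp [Finset.mem_finsuppAntidiag, Finsupp.degree_eq_sum]
  rw [hset, Finset.card_biUnion]
  · simp only [Finset.card_finsuppAntidiag_nat_eq_choose, Finset.card_univ, Fintype.card_fin]
    induction N with
    | zero => simp
    | succ N ih =>
      rw [Finset.sum_range_succ, ih, ← add_assoc, Nat.add_sub_cancel, Nat.choose_succ_succ]
  · intro r _ r' _ hrr
    rw [Function.onFun, Finset.disjoint_left]
    intro s hs hs'
    rw [Finset.mem_finsuppAntidiag] at hs hs'
    exact hrr (hs.1.symm.trans hs'.1)

theorem finrank_restrictTotalDegree_fin (k N : ℕ) :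
    finrank F (restrictTotalDegree (Fin k) F N) = (k + N).choose N := by
  rw [finrank_restrictTotalDegree_eq_card, card_degree_le]

end Dimension

/-! ### Coefficients with respect to one group of variables -/

section Slices

open Module MvPolynomial

variable {F : Type*} [Field F] {ι κ τ E : Type*}

/-- The coefficient of `Y ^ b` of a polynomial in the two groups of variables `Y : κ`, `X : ι`. -/
noncomputable def slice (e : τ ≃ κ ⊕ ι) (b : κ →₀ ℕ) :
    MvPolynomial τ F →ₗ[F] MvPolynomial ι F where
  toFun g := coeff b (sumAlgEquiv F κ ι (rename e g))
  map_add' f g := by simp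
  map_smul' c f := by simp

/-- The exponent of the product of the monomials `Y ^ b` and `X ^ a`. -/
noncomputable def glue (e : τ ≃ κ ⊕ ι) (b : κ →₀ ℕ) (a : ι →₀ ℕ) : τ →₀ ℕ :=
  (Finsupp.sumElim b a).mapDomain e.symm

theorem sumAlgEquiv_monomial_sumElim (b : κ →₀ ℕ) (a : ι →₀ ℕ) (c : F) :
    sumAlgEquiv F κ ι (monomial (Finsupp.sumElim b a) c) = monomial b (monomial a c) := by
  have : Finsupp.sumFinsuppAddEquivProdFinsupp (Finsupp.sumElim b a) = (b, a) :=
    Finsupp.sumFinsuppEquivProdFinsupp.apply_symm_apply (b, a)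
  simp [sumAlgEquiv, monomial, this]
theorem coeff_coeff_sumAlgEquiv (b : κ →₀ ℕ) (a : ι →₀ ℕ) (h : MvPolynomial (κ ⊕ ι) F) :
    coeff a (coeff b (sumAlgEquiv F κ ι h)) = coeff (Finsupp.sumElim b a) h := by
  classical
  induction h using MvPolynomial.induction_on' with
  | monomial u c =>
    obtain ⟨⟨b', a'⟩, rfl⟩ := Finsupp.sumFinsuppEquivProdFinsupp.symm.surjective u
    change coeff a (coeff b (sumAlgEquiv F κ ι (monomial (Finsupp.sumElim b' a') c))) =
      coeff (Finsupp.sumElim b a) (monomial (Finsupp.sumElim b' a') c)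
    have h : Finsupp.sumElim b' a' = Finsupp.sumElim b a ↔ b' = b ∧ a' = a := by
      rw [← Prod.mk_inj]
      exact Finsupp.sumFinsuppEquivProdFinsupp.symm.injective.eq_iff (a := (b', a')) (b := (b, a))
    rw [sumAlgEquiv_monomial_sumElim, coeff_monomial, coeff_monomial]
    rw [if_congr h rfl rfl]
    by_cases hb : b' = b <;> simp [hb, coeff_monomial]
  | add p q hp hq => simp [hp, hq]

theorem coeff_slice (e : τ ≃ κ ⊕ ι) (b : κ →₀ ℕ) (a : ι →₀ ℕ) (g : MvPolynomial τ F) :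
    coeff a (slice e b g) = coeff (glue e b a) g := by
  have h1 : Finsupp.mapDomain e (glue e b a) = Finsupp.sumElim b a := by
    rw [glue, ← Finsupp.mapDomain_comp]; simp
  rw [← coeff_rename_mapDomain e e.injective, h1]
  exact coeff_coeff_sumAlgEquiv b a _

theorem degree_glue (e : τ ≃ κ ⊕ ι) (b : κ →₀ ℕ) (a : ι →₀ ℕ) :
    (glue e b a).degree = b.degree + a.degree := by
  rw [glue, Finsupp.degree_mapDomain, Finsupp.sumElim_eq_add, map_add, Finsupp.degree_mapDomain,
    Finsupp.degree_mapDomain]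

theorem totalDegree_le_iff_coeff {g : MvPolynomial ι F} {N : ℕ} :
    g.totalDegree ≤ N ↔ ∀ s : ι →₀ ℕ, N < s.degree → coeff s g = 0 := by
  rw [totalDegree, Finset.sup_le_iff]
  refine forall_congr' fun s => ?_
  rw [MvPolynomial.mem_support_iff, not_imp_comm, not_le]
  rfl

theorem exists_eq_glue (e : τ ≃ κ ⊕ ι) (d : τ →₀ ℕ) : ∃ b a, d = glue e b a := by
  refine ⟨(Finsupp.sumFinsuppEquivProdFinsupp (d.mapDomain e)).1,
    (Finsupp.sumFinsuppEquivProdFinsupp (d.mapDomain e)).2, ?_⟩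
  have : Finsupp.sumElim (Finsupp.sumFinsuppEquivProdFinsupp (d.mapDomain e)).1
    (Finsupp.sumFinsuppEquivProdFinsupp (d.mapDomain e)).2 = d.mapDomain e :=
    Finsupp.sumFinsuppEquivProdFinsupp.symm_apply_apply (d.mapDomain e)
  rw [glue, this, ← Finsupp.mapDomain_comp]; simp

/-- Like a derivative of order `|b|` across the slice `Y = 0`, taking the coefficient of `Y ^ b`
loses at most `|b|` orders of vanishing. -/
theorem coeff_mem_pow_of_mem_pow {A R : Type*} [CommRing A] [CommRing R]
    (Ψ : R →+* MvPolynomial κ A) {I : Ideal R} {J : Ideal A} (h : ∀ f ∈ I, coeff 0 (Ψ f) ∈ J)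
    {k : ℕ} {f : R} (hf : f ∈ I ^ k) (b : κ →₀ ℕ) : coeff b (Ψ f) ∈ J ^ (k - b.degree) := by
  classical
  induction k generalizing f b with
  | zero => simp
  | succ k ih =>
    rw [pow_succ'] at hf
    induction hf using Submodule.mul_induction_on' with
    | mem_mul_mem f hf g hg =>
      rw [map_mul, coeff_mul]
      refine Ideal.sum_mem _ fun c hc => ?_
      have hdeg : c.1.degree + c.2.degree = b.degree := by
        rw [← Finset.HasAntidiagonal.mem_antidiagonal.1 hc, map_add]
      -- Either the first factor contributes its constant term in `Y`, which lies in `J`, or it uses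
      -- up at least one of the `|b|` orders that may be lost.
      by_cases h0 : c.1.degree = 0
      · have h1 : coeff c.1 (Ψ f) * coeff c.2 (Ψ g) ∈ J ^ (k - c.2.degree + 1) := by
          rw [pow_succ', (Finsupp.degree_eq_zero_iff _).1 h0]
          exact Ideal.mul_mem_mul (h f hf) (ih hg c.2)
        exact Ideal.pow_le_pow_right (by omega) h1
      · exact Ideal.mul_mem_left _ _ (Ideal.pow_le_pow_right (by omega) (ih hg c.2))
    | add f _ g _ hf hg => rw [map_add, coeff_add]; exact Ideal.add_mem _ hf hg

theorem eval_slice_zero (e : τ ≃ κ ⊕ ι) (x : ι → F) (g : MvPolynomial τ F) :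
    eval x (slice e 0 g) = eval (Sum.elim (0 : κ → F) x ∘ e) g := by
  have : ((eval x).comp (constantCoeff (R := MvPolynomial ι F) (σ := κ))).comp
      ((sumAlgEquiv F κ ι).toRingEquiv.toRingHom.comp (rename e).toRingHom) =
      eval (Sum.elim (0 : κ → F) x ∘ e) := by
    refine MvPolynomial.ringHom_ext (fun c => ?_) fun t => ?_
    · simp
    · rcases h : e t with s | s <;> simp [h]
  exact RingHom.congr_fun this g

theorem slice_mem_pow (e : τ ≃ κ ⊕ ι) {φ : (τ → F) → E} {φ' : (ι → F) → E}
    (h : ∀ y, φ' y = φ (Sum.elim (0 : κ → F) y ∘ e)) (x : E) {k : ℕ} {g : MvPolynomial τ F}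
    (hg : g ∈ fiberIdeal φ x ^ k) (b : κ →₀ ℕ) :
    slice e b g ∈ fiberIdeal φ' x ^ (k - b.degree) := by
  refine coeff_mem_pow_of_mem_pow
    ((sumAlgEquiv F κ ι).toRingEquiv.toRingHom.comp (rename e).toRingHom) (fun f hf => ?_) hg b
  rw [mem_fiberIdeal] at hf ⊢
  intro y hy
  exact (eval_slice_zero e y f).trans (hf _ (by rw [← h, hy]))

theorem totalDegree_slice_le (e : τ ≃ κ ⊕ ι) (b : κ →₀ ℕ) (g : MvPolynomial τ F) :
    (slice e b g).totalDegree ≤ g.totalDegree := by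
  rw [totalDegree_le_iff_coeff]
  intro s hs
  rw [coeff_slice]
  exact totalDegree_le_iff_coeff.1 le_rfl _ (by rw [degree_glue]; omega)

theorem homogeneousComponent_slice (e : τ ≃ κ ⊕ ι) (b : κ →₀ ℕ) (g : MvPolynomial τ F) (r : ℕ) :
    homogeneousComponent r (slice e b g) = slice e b (homogeneousComponent (r + b.degree) g) := by
  ext a
  simp only [coeff_homogeneousComponent, coeff_slice, degree_glue]
  congr 1
  rw [eq_iff_iff]; omega

end Slices

/-! ### Leading forms and submultiplicativity of shares -/

section LeadingForms

open Module MvPolynomial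

variable {F : Type*} [Field F] {ι κ E : Type*} {m : ℕ}

/-- The span of the leading forms at the origin (which maps to `x p`) of the polynomials that
satisfy the conditions imposed before `p` gets processed to the corresponding order. -/
noncomputable def leadingForms (φ : (ι → F) → E) (x : Fin m → E) (a : Fin m → ℕ) (N : ℕ)
    (p : Fin m) : Submodule F (MvPolynomial ι F) :=
  ⨅ r : ℕ, ((jetSpace (restrictTotalDegree ι F N) (fun q => fiberIdeal φ (x q)) a (a p + r) p).map
    (homogeneousComponent r)).comap (homogeneousComponent r)

theorem mem_leadingForms {φ : (ι → F) → E} {x : Fin m → E} {a : Fin m → ℕ} {N : ℕ}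
    {p : Fin m} {h : MvPolynomial ι F} :
    h ∈ leadingForms φ x a N p ↔ ∀ r, ∃ g ∈ jetSpace (restrictTotalDegree ι F N)
      (fun q => fiberIdeal φ (x q)) a (a p + r) p,
        homogeneousComponent r g = homogeneousComponent r h := by
  simp [leadingForms]

/-- At time `a p + r` all polynomials left vanish to order `r` at the origin, so the new conditions
at `p` say exactly that the component of degree `r` is zero. -/
theorem jetDrop_eq_finrank_map [Fintype ι] {φ : (ι → F) → E} (hφ : Function.Injective φ)
    {x : Fin m → E} {p : Fin m} (hp : φ 0 = x p) (a : Fin m → ℕ) (N r : ℕ) :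
    jetDrop (restrictTotalDegree ι F N) (fun q => fiberIdeal φ (x q)) a (a p + r) p =
      finrank F ((jetSpace (restrictTotalDegree ι F N) (fun q => fiberIdeal φ (x q)) a
        (a p + r) p).map (homogeneousComponent r)) := by
  have hI : fiberIdeal φ (x p) = idealOfVars ι F := by
    rw [← hp, fiberIdeal_eq_ker hφ, ker_eval_zero]
  rw [jetDrop_eq_finrank_sub]
  set U := jetSpace (restrictTotalDegree ι F N) (fun q => fiberIdeal φ (x q)) a (a p + r) p with hU
  have h1 := LinearMap.finrank_range_add_finrank_ker ((homogeneousComponent r).domRestrict U)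
  rw [LinearMap.range_domRestrict] at h1
  have h2 : (LinearMap.ker ((homogeneousComponent r).domRestrict U)).map U.subtype =
      U ⊓ (fiberIdeal φ (x p) ^ (a p + r + 1 - a p)).restrictScalars F := by
    ext g
    simp only [Submodule.mem_map, LinearMap.mem_ker, LinearMap.domRestrict_apply,
      Submodule.subtype_apply, Subtype.exists, exists_and_left, exists_prop, Submodule.mem_inf,
      Submodule.restrictScalars_mem]
    have hr : a p + r + 1 - a p = r + 1 := by omega
    rw [hI, hr, mem_pow_idealOfVars_iff']
    have hg : g ∈ U → ∀ s, Finsupp.degree s < r → coeff s g = 0 := by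
      intro hg
      have := (mem_jetSpace.1 hg).2 p
      rw [hI] at this
      rw [← mem_pow_idealOfVars_iff']
      simpa using this
    constructor
    · rintro ⟨g', h, hg', rfl⟩
      refine ⟨hg', fun s hs => ?_⟩
      rcases Nat.lt_succ_iff_lt_or_eq.1 hs with hs | hs
      · exact hg hg' s hs
      · have := congrArg (coeff s) h
        rwa [coeff_homogeneousComponent, if_pos hs, coeff_zero] at this
    · rintro ⟨h, h'⟩
      refine ⟨g, ?_, h, rfl⟩
      ext s
      rw [coeff_homogeneousComponent]
      split_ifs with hs
      · rw [h' s (by omega), coeff_zero]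
      · rw [coeff_zero]
  rw [← h2, Submodule.finrank_map_subtype_eq U]
  omega

theorem leadingForms_le [Fintype ι] (φ : (ι → F) → E) (x : Fin m → E) (a : Fin m → ℕ) (N : ℕ)
    (p : Fin m) : leadingForms φ x a N p ≤ restrictTotalDegree ι F N := by
  intro h hh
  rw [mem_restrictTotalDegree, totalDegree_le_iff_coeff]
  intro s hs
  obtain ⟨g, hg, hgh⟩ := mem_leadingForms.1 hh s.degree
  have h1 := congrArg (coeff s) hgh
  rw [coeff_homogeneousComponent, coeff_homogeneousComponent, if_pos rfl, if_pos rfl] at h1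
  rw [← h1]
  exact totalDegree_le_iff_coeff.1 ((mem_restrictTotalDegree _ _ _).1
    (jetSpace_le _ _ _ _ _ hg)) s hs

instance [Fintype ι] (φ : (ι → F) → E) (x : Fin m → E) (a : Fin m → ℕ) (N : ℕ)
    (p : Fin m) : FiniteDimensional F (leadingForms φ x a N p) :=
  Submodule.finiteDimensional_of_le (leadingForms_le φ x a N p)

/-- The space of leading forms is graded, and its piece of degree `r` has the dimension of the drop
at time `a p + r`; pieces beyond degree `N` vanish. -/
theorem finrank_leadingForms [Fintype ι] {φ : (ι → F) → E} (hφ : Function.Injective φ)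
    {x : Fin m → E} {p : Fin m} (hp : φ 0 = x p) (a : Fin m → ℕ) {N S : ℕ}
    (hS : N + 1 + a p ≤ S) :
    polyShare φ x a N S p = finrank F (leadingForms φ x a N p) := by
  set U := fun r => jetSpace (restrictTotalDegree ι F N) (fun q => fiberIdeal φ (x q)) a
    (a p + r) p with hU
  have h0 : ∀ r, N < r → (U r).map (homogeneousComponent r) = ⊥ := by
    intro r hr
    rw [eq_bot_iff]
    rintro _ ⟨g, hg, rfl⟩
    have := jetSpace_le _ _ _ _ _ hg
    rw [mem_restrictTotalDegree] at this
    exact homogeneousComponent_eq_zero _ _ (by omega)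
  obtain ⟨R, rfl⟩ := Nat.exists_eq_add_of_le hS
  have h1 : polyShare φ x a N (N + 1 + a p + R) p =
      ∑ r ∈ Finset.range (N + 1), finrank F ((U r).map (homogeneousComponent r)) := by
    rw [polyShare, share, show N + 1 + a p + R = a p + ((N + 1) + R) by ring,
      Finset.sum_range_add, Finset.sum_range_add _ (N + 1)]
    have e1 : ∑ s ∈ Finset.range (a p), jetDrop (restrictTotalDegree ι F N)
        (fun q => fiberIdeal φ (x q)) a s p = 0 :=
      Finset.sum_eq_zero fun s hs => jetDrop_eq_zero_of_lt _ _ _ _ _ (Finset.mem_range.1 hs)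
    simp only [jetDrop_eq_finrank_map hφ hp] at e1 ⊢
    rw [e1, zero_add]
    refine (add_eq_left.2 (Finset.sum_eq_zero fun s _ => ?_)).trans rfl
    have := h0 (N + 1 + s) (by omega)
    simp only [hU] at this
    rw [this, finrank_bot]
  rw [h1, Finset.sum_range]
  have hfin : ∀ r, FiniteDimensional F ((U r).map (homogeneousComponent r)) := fun r => by
    infer_instance
  rw [← Module.finrank_pi_fintype F
    (M := fun r : Fin (N + 1) => (U r).map (homogeneousComponent r))]
  symm
  have hsum : ∀ v : ∀ r : Fin (N + 1), (U r).map (homogeneousComponent r), ∀ r : Fin (N + 1),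
      homogeneousComponent r (∑ i : Fin (N + 1), (v i : MvPolynomial ι F)) = v r := by
    intro v r
    have hv : ∀ i : Fin (N + 1), (v i : MvPolynomial ι F) ∈
        homogeneousSubmodule ι F (i : ℕ) := fun i => by
      obtain ⟨g, _, hg⟩ := (v i).2
      rw [← hg]; exact homogeneousComponent_mem _ _
    rw [map_sum, Finset.sum_eq_single r]
    · rw [homogeneousComponent_of_mem (hv r), if_pos rfl]
    · intro i _ hi
      rw [homogeneousComponent_of_mem (hv i), if_neg (fun h => hi (Fin.ext h.symm))]
    · simp
  refine LinearEquiv.finrank_eq (LinearEquiv.ofBijective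
    (LinearMap.pi fun r : Fin (N + 1) => ((homogeneousComponent (r : ℕ)).restrict
      (p := leadingForms φ x a N p) (q := (U r).map (homogeneousComponent r))
      fun h hh => mem_leadingForms.1 hh r)) ⟨?_, fun v => ?_⟩)
  · rw [← LinearMap.ker_eq_bot, eq_bot_iff]
    intro h hh
    rw [LinearMap.mem_ker] at hh
    rw [Submodule.mem_bot]
    ext s
    rw [ZeroMemClass.coe_zero, coeff_zero]
    by_cases hs : N < s.degree
    · exact totalDegree_le_iff_coeff.1 ((mem_restrictTotalDegree _ _ _).1
        (leadingForms_le _ _ _ _ _ h.2)) s hs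
    · have h2 : homogeneousComponent s.degree h.1 = 0 :=
        congrArg Subtype.val (congrFun hh ⟨s.degree, by omega⟩)
      have h3 := congrArg (coeff s) h2
      rwa [coeff_homogeneousComponent, if_pos rfl, coeff_zero] at h3
  · refine ⟨⟨∑ i : Fin (N + 1), (v i : MvPolynomial ι F), mem_leadingForms.2 fun r => ?_⟩, ?_⟩
    · by_cases hr : r < N + 1
      · rw [hsum v ⟨r, hr⟩]
        exact (v ⟨r, hr⟩).2
      · refine ⟨0, Submodule.zero_mem _, ?_⟩
        have hd : (∑ i : Fin (N + 1), (v i : MvPolynomial ι F)).totalDegree ≤ N := by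
          rw [← mem_restrictTotalDegree]
          refine Submodule.sum_mem _ fun i _ => ?_
          obtain ⟨g, hg, hgi⟩ := (v i).2
          rw [← hgi, mem_restrictTotalDegree]
          exact (homogeneousComponent_isHomogeneous _ _).totalDegree_le.trans (by omega)
        rw [map_zero, homogeneousComponent_eq_zero _ _ (by omega)]
    · ext r : 2
      exact hsum v r

/-- Slicing by `Y ^ b` lowers the degree of the leading form and the order at every point by the
same `|b|`, so the witness for degree `r` is the slice of the witness for degree `r + |b|`. -/
theorem slice_mem_leadingForms {τ : Type*} (e : τ ≃ κ ⊕ ι) {φ : (τ → F) → E} {φ' : (ι → F) → E}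
    (hφ : ∀ y, φ' y = φ (Sum.elim (0 : κ → F) y ∘ e)) {x : Fin m → E} {p : Fin m} {a : Fin m → ℕ}
    {N : ℕ} {h : MvPolynomial τ F} (hh : h ∈ leadingForms φ x a N p) (b : κ →₀ ℕ) :
    slice e b h ∈ leadingForms φ' x a N p := by
  rw [mem_leadingForms] at hh ⊢
  intro r
  obtain ⟨g, hg, hgh⟩ := hh (r + b.degree)
  refine ⟨slice e b g, ?_, by rw [homogeneousComponent_slice, homogeneousComponent_slice, hgh]⟩
  rw [mem_jetSpace, mem_restrictTotalDegree] at hg ⊢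
  refine ⟨(totalDegree_slice_le e b g).trans hg.1, fun q => ?_⟩
  exact Ideal.pow_le_pow_right (by omega) (slice_mem_pow e hφ (x q) (hg.2 q) b)

/-- Among the coefficient functionals on `T` choose a linearly independent family with the same
span. -/
theorem exists_finset_separating (T : Submodule F (MvPolynomial ι F)) [FiniteDimensional F T] :
    ∃ A : Finset (ι →₀ ℕ), A.card ≤ finrank F T ∧ ∀ h ∈ T, (∀ s ∈ A, coeff s h = 0) → h = 0 := by
  classical
  let c : (ι →₀ ℕ) → Dual F T := fun s => (lcoeff F s) ∘ₗ T.subtype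
  obtain ⟨b, hb, hspan, hli⟩ := exists_linearIndependent F (Set.range c)
  have hbf : b.Finite := hli.setFinite
  have := hbf.fintype
  choose t ht using fun i : b => hb i.2
  refine ⟨Finset.univ.image t, ?_, fun h hh h0 => ?_⟩
  · refine Finset.card_image_le.trans ?_
    rw [Finset.card_univ, ← Subspace.dual_finrank_eq (V := T)]
    exact hli.fintype_card_le_finrank
  · have hk : ∀ f ∈ Submodule.span F b, f ⟨h, hh⟩ = 0 := by
      intro f hf
      induction hf using Submodule.span_induction with
      | mem f hf =>
        rw [show f = c (t ⟨f, hf⟩) from (ht ⟨f, hf⟩).symm]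
        exact h0 _ (Finset.mem_image_of_mem _ (Finset.mem_univ _))
      | zero => rfl
      | add f g _ _ hf hg => rw [LinearMap.add_apply, hf, hg, add_zero]
      | smul c f _ hf => rw [LinearMap.smul_apply, hf, smul_zero]
    ext s
    exact hk (c s) (hspan ▸ Submodule.subset_span ⟨s, rfl⟩)

theorem glue_sumComm (b : κ →₀ ℕ) (s : ι →₀ ℕ) :
    glue (Equiv.sumComm ι κ) b s = glue (Equiv.refl (ι ⊕ κ)) s b := by
  have h : ⇑(Equiv.sumComm ι κ).symm = Sum.swap := rfl
  rw [glue, glue, h, Finsupp.mapDomain_swap_sumElim]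
  exact Finsupp.mapDomain_id.symm

/-- Such a `T` sits inside the tensor product of `T₁` and `T₂`: if `A` and `B` are sets of exponents
that determine elements of `T₁` and `T₂`, the coefficients in `A × B` determine those of `T`. -/
theorem finrank_le_mul_of_slices {T : Submodule F (MvPolynomial (ι ⊕ κ) F)}
    {T₁ : Submodule F (MvPolynomial ι F)} {T₂ : Submodule F (MvPolynomial κ F)}
    [FiniteDimensional F T] [FiniteDimensional F T₁] [FiniteDimensional F T₂]
    (hs₁ : ∀ h ∈ T, ∀ b, slice (Equiv.sumComm ι κ) b h ∈ T₁)
    (hs₂ : ∀ h ∈ T, ∀ s, slice (Equiv.refl (ι ⊕ κ)) s h ∈ T₂) :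
    finrank F T ≤ finrank F T₁ * finrank F T₂ := by
  classical
  obtain ⟨A, hA, hA'⟩ := exists_finset_separating T₁
  obtain ⟨B, hB, hB'⟩ := exists_finset_separating T₂
  let Φ : T →ₗ[F] (A ×ˢ B : Finset _) → F :=
    LinearMap.pi fun c => lcoeff F (glue (Equiv.refl (ι ⊕ κ)) c.1.1 c.1.2) ∘ₗ T.subtype
  have hΦ : Function.Injective Φ := by
    rw [← LinearMap.ker_eq_bot, eq_bot_iff]
    intro h hh
    rw [LinearMap.mem_ker] at hh
    rw [Submodule.mem_bot]
    have h1 : ∀ b ∈ B, slice (Equiv.sumComm ι κ) b h.1 = 0 := fun b hb =>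
      hA' _ (hs₁ _ h.2 b) fun s hs => by
        rw [coeff_slice, glue_sumComm]
        exact congrFun hh ⟨(s, b), Finset.mem_product.2 ⟨hs, hb⟩⟩
    have h2 : ∀ s, slice (Equiv.refl (ι ⊕ κ)) s h.1 = 0 := fun s =>
      hB' _ (hs₂ _ h.2 s) fun b hb => by
        rw [coeff_slice, ← glue_sumComm, ← coeff_slice, h1 b hb, coeff_zero]
    ext d
    obtain ⟨s, b, rfl⟩ := exists_eq_glue (Equiv.refl (ι ⊕ κ)) d
    rw [← coeff_slice, h2]
    simp
  have h := LinearMap.finrank_le_finrank_of_injective hΦ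
  rw [Module.finrank_fintype_fun_eq_card, Fintype.card_coe, Finset.card_product] at h
  exact h.trans (Nat.mul_le_mul hA hB)

theorem finrank_leadingForms_sum_le [Fintype ι] [Fintype κ] (φ : (ι ⊕ κ → F) → E)
    (x : Fin m → E) (a : Fin m → ℕ) (N : ℕ) (p : Fin m) :
    finrank F (leadingForms φ x a N p) ≤
      finrank F (leadingForms (fun y => φ (Sum.elim y 0)) x a N p) *
        finrank F (leadingForms (fun y => φ (Sum.elim 0 y)) x a N p) := by
  refine finrank_le_mul_of_slices
    (fun h hh b => slice_mem_leadingForms (Equiv.sumComm ι κ) (fun y => ?_) hh b)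
    fun h hh b => slice_mem_leadingForms (Equiv.refl (ι ⊕ κ)) (fun y => rfl) hh b
  congr 1
  ext i
  rcases i with i | i <;> rfl

/-- The share of a point is submultiplicative with respect to direct sums of directions. -/
theorem polyShare_sum_le [Fintype ι] [Fintype κ] {φ : (ι ⊕ κ → F) → E}
    (hφ : Function.Injective φ) {x : Fin m → E} {p : Fin m} (hp : φ 0 = x p) (a : Fin m → ℕ)
    {N S : ℕ} (hS : N + 1 + a p ≤ S) :
    polyShare φ x a N S p ≤ polyShare (fun y => φ (Sum.elim y 0)) x a N S p *
      polyShare (fun y => φ (Sum.elim 0 y)) x a N S p := by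
  have h0 : Sum.elim (0 : ι → F) (0 : κ → F) = 0 := by
    ext i; rcases i with i | i <;> rfl
  rw [finrank_leadingForms hφ hp a hS, finrank_leadingForms _ _ a hS, finrank_leadingForms _ _ a hS]
  · exact finrank_leadingForms_sum_le φ x a N p
  · intro y z h
    have := hφ h
    ext i; exact congrFun this (Sum.inr i)
  · simpa [h0] using hp
  · intro y z h
    have := hφ h
    ext i; exact congrFun this (Sum.inl i)
  · simpa [h0] using hp

end LeadingForms

/-! ### Shares indexed by a point and a direction -/

section PlaneShares

open Module MvPolynomial

theorem affineParam_injective {ι F E : Type*} [Field F] [AddCommGroup E] [Module F E]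
    {B : (ι → F) →ₗ[F] E} (hB : Function.Injective B)
    (u : E) : Function.Injective fun y => u + B y :=
  (add_right_injective u).comp hB

variable {F : Type*} [Field F] {E : Type*} [AddCommGroup E] [Module F E] [FiniteDimensional F E]
  {m : ℕ}

/-- A linear parametrisation of a subspace. -/
noncomputable def subspaceParam (V : Submodule F E) : (Fin (finrank F V) → F) →ₗ[F] E :=
  V.subtype ∘ₗ (finBasis F V).equivFun.symm.toLinearMap

theorem subspaceParam_injective (V : Submodule F E) : Function.Injective (subspaceParam V) :=
  V.injective_subtype.comp (finBasis F V).equivFun.symm.injective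

theorem range_subspaceParam (V : Submodule F E) : LinearMap.range (subspaceParam V) = V := by
  rw [subspaceParam, LinearMap.range_comp_of_range_eq_top _ (LinearEquiv.range _),
    Submodule.range_subtype]

/-- The share of the point `x p` on the plane through `x p` with direction `V`. -/
noncomputable def planeShare (x : Fin m → E) (a : Fin m → ℕ) (N S : ℕ) (V : Submodule F E)
    (p : Fin m) : ℕ :=
  polyShare (fun y => x p + subspaceParam V y) x a N S p

theorem exists_affineParam_eq {V : Submodule F E} {u z : E} :
    (∃ y, u + subspaceParam V y = z) ↔ z - u ∈ V := by
  conv_rhs => rw [← range_subspaceParam V]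
  simp only [LinearMap.mem_range, eq_sub_iff_add_eq']

open Classical in
theorem polyShare_eq_planeShare (x : Fin m → E) (a : Fin m → ℕ) (N S : ℕ) (V : Submodule F E)
    (u : E) (p : Fin m) : polyShare (fun y => u + subspaceParam V y) x a N S p =
      if x p - u ∈ V then planeShare x a N S V p else 0 := by
  split_ifs with h
  · exact polyShare_congr (subspaceParam_injective V) (subspaceParam_injective V) rfl
      (by rwa [range_subspaceParam]) x a N S p
  · refine polyShare_eq_zero fun y hy => h ?_
    exact exists_affineParam_eq.1 ⟨y, hy⟩

open Classical in
theorem sum_planeShare (x : Fin m → E) (a : Fin m → ℕ) {N S : ℕ} (V : Submodule F E)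
    {u : E} {q : Fin m} (hq : x q - u ∈ V) (hS : N + 1 + a q ≤ S) :
    ∑ p, (if x p - u ∈ V then planeShare x a N S V p else 0) =
      (finrank F V + N).choose N := by
  rw [← finrank_restrictTotalDegree_fin F, ← sum_polyShare
    (affineParam_injective (subspaceParam_injective V) u) (exists_affineParam_eq.2 hq) hS]
  exact Finset.sum_congr rfl fun p _ => (polyShare_eq_planeShare x a N S V u p).symm

theorem planeShare_le (x : Fin m → E) (a : Fin m → ℕ) {N S : ℕ} (V : Submodule F E)
    {p : Fin m} (hS : N + 1 + a p ≤ S) :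
    planeShare x a N S V p ≤ (finrank F V + N).choose N := by
  rw [← finrank_restrictTotalDegree_fin F]
  exact polyShare_le_finrank (affineParam_injective (subspaceParam_injective V) _) hS

theorem planeShare_mono_delay {x : Fin m → E} {a a' : Fin m → ℕ} {N S : ℕ} {V : Submodule F E}
    {p : Fin m} (h : ∀ q, a q ≤ a' q) (hp : a p = a' p) :
    planeShare x a N S V p ≤ planeShare x a' N S V p :=
  polyShare_mono_delay h hp

theorem planeShare_le_add {x : Fin m → E} (hx : Function.Injective x) {a a' : Fin m → ℕ} {N S : ℕ}
    (V : Submodule F E) {p : Fin m} (ha : ∀ q, q ≠ p → a' q = a q) (hap : a p = a' p + 1)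
    (hS : N + 2 + a p ≤ S) :
    planeShare x a' (N + 1) S V p + (finrank F V + N).choose N ≤
      planeShare x a (N + 1) S V p + (finrank F V + (N + 1)).choose (N + 1) := by
  rw [← finrank_restrictTotalDegree_fin F, ← finrank_restrictTotalDegree_fin F]
  exact polyShare_le_add (affineParam_injective (subspaceParam_injective V) _) hx
    ⟨0, by simp⟩ ha hap hS

theorem planeShare_sup_le (x : Fin m → E) (a : Fin m → ℕ) {N S : ℕ} {V W : Submodule F E}
    (hVW : Disjoint V W) {p : Fin m} (hS : N + 1 + a p ≤ S) :
    planeShare x a N S (V ⊔ W) p ≤ planeShare x a N S V p * planeShare x a N S W p := by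
  let B : (Fin (finrank F V) ⊕ Fin (finrank F W) → F) →ₗ[F] E :=
    ((subspaceParam V).coprod (subspaceParam W)) ∘ₗ
      (LinearEquiv.sumArrowLequivProdArrow (Fin (finrank F V)) (Fin (finrank F W)) F F).toLinearMap
  have hr : LinearMap.range B = V ⊔ W := by
    rw [LinearMap.range_comp_of_range_eq_top _ (LinearEquiv.range _), LinearMap.range_coprod,
      range_subspaceParam, range_subspaceParam]
  have hB : Function.Injective B := by
    refine Function.Injective.comp (g := (subspaceParam V).coprod (subspaceParam W)) ?_
      (LinearEquiv.sumArrowLequivProdArrow _ _ F F).injective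
    rw [← LinearMap.ker_eq_bot, LinearMap.ker_coprod_of_disjoint_range,
      LinearMap.ker_eq_bot.2 (subspaceParam_injective V),
      LinearMap.ker_eq_bot.2 (subspaceParam_injective W), Submodule.prod_bot]
    rwa [range_subspaceParam, range_subspaceParam]
  have h1 : planeShare x a N S (V ⊔ W) p = polyShare (fun y => x p + B y) x a N S p :=
    polyShare_congr (subspaceParam_injective _) hB (by rw [hr, range_subspaceParam])
      (by rw [sub_self]; exact Submodule.zero_mem _) x a N S p
  have h2 := polyShare_sum_le (affineParam_injective hB (x p)) (x := x) (p := p) (by simp) a hS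
  rw [h1]
  refine h2.trans (le_of_eq ?_)
  congr 1
  · refine congrArg (fun f => polyShare f x a N S p) (funext fun y => ?_)
    congr 1
    change subspaceParam V y + subspaceParam W 0 = _
    rw [map_zero, add_zero]
  · refine congrArg (fun f => polyShare f x a N S p) (funext fun y => ?_)
    congr 1
    change subspaceParam V 0 + subspaceParam W y = _
    rw [map_zero, zero_add]

theorem finrank_finset_sup_le {J : Type*} (s : Finset J) (V : J → Submodule F E) :
    finrank F (s.sup V : Submodule F E) ≤ ∑ j ∈ s, finrank F (V j) := by
  classical
  induction s using Finset.induction_on with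
  | empty => simp
  | insert j s hj ih =>
    rw [Finset.sup_insert, Finset.sum_insert hj]
    exact (Submodule.finrank_add_le_finrank_add_finrank _ _).trans (by omega)

theorem planeShare_finset_sup_le (x : Fin m → E) (a : Fin m → ℕ) {N S : ℕ} {J : Type*}
    (s : Finset J) (V : J → Submodule F E)
    (hV : finrank F (s.sup V : Submodule F E) = ∑ j ∈ s, finrank F (V j))
    {p : Fin m} (hS : N + 1 + a p ≤ S) :
    planeShare x a N S (s.sup V) p ≤ ∏ j ∈ s, planeShare x a N S (V j) p := by
  classical
  induction s using Finset.induction_on with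
  | empty =>
    -- On a single point the polynomials have dimension 1, which is the empty product.
    refine (planeShare_le x a _ hS).trans ?_
    rw [Finset.sup_empty, finrank_bot]
    simp
  | insert j s hj ih =>
    rw [Finset.sup_insert, Finset.sum_insert hj] at hV
    rw [Finset.sup_insert, Finset.prod_insert hj]
    have h1 := Submodule.finrank_sup_add_finrank_inf_eq (V j) (s.sup V)
    have h2 := finrank_finset_sup_le s V
    have h3 : Disjoint (V j) (s.sup V) := by
      -- Additivity of the dimensions over the whole family leaves no room for an intersection.
      rw [disjoint_iff, ← Submodule.finrank_eq_zero (R := F)]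
      omega
    exact (planeShare_sup_le x a h3 hS).trans (Nat.mul_le_mul_left _ (ih (by omega)))

theorem planeShare_top_le_prod (x : Fin m → E) (a : Fin m → ℕ) {N S d : ℕ}
    {V : Fin d → Submodule F E} (hV : ⨆ j, V j = ⊤) (hk : ∑ j, finrank F (V j) = finrank F E)
    {p : Fin m} (hS : N + 1 + a p ≤ S) :
    planeShare x a N S (⊤ : Submodule F E) p ≤ ∏ j, planeShare x a N S (V j) p := by
  rw [← Finset.sup_univ_eq_iSup] at hV
  rw [← hV]
  exact planeShare_finset_sup_le x a _ V (by rw [hV, hk, finrank_top]) hS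

/-- Points outside `U` enter after `q` has exhausted the polynomials, so `U` receives all of the
shares in the whole space. -/
theorem sum_planeShare_top_of_gap (x : Fin m → E) (a : Fin m → ℕ) {N S : ℕ} {U : Finset (Fin m)}
    {q : Fin m} (hU : ∀ v ∉ U, N + 1 + a q ≤ a v) (hS : N + 1 + a q ≤ S) :
    ∑ p ∈ U, planeShare x a N S (⊤ : Submodule F E) p = (finrank F E + N).choose N := by
  have h := sum_planeShare x a (u := 0) (⊤ : Submodule F E) (q := q) trivial hS
  simp only [Submodule.mem_top, if_true, finrank_top] at h
  rw [← h]
  refine Finset.sum_subset (Finset.subset_univ U) fun v _ hv => ?_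
  exact polyShare_eq_zero_of_late (affineParam_injective (subspaceParam_injective _) _)
    (exists_affineParam_eq.2 trivial) (hU v hv)

end PlaneShares

/-! ### Binomial estimates -/

section Binomials

theorem ascFactorial_le_ascFactorial {n n' : ℕ} (h : n ≤ n') (k : ℕ) :
    n.ascFactorial k ≤ n'.ascFactorial k := by
  induction k with
  | zero => simp
  | succ k ih =>
    rw [Nat.ascFactorial_succ, Nat.ascFactorial_succ]
    exact Nat.mul_le_mul (by omega) ih

/-- Here `k! * C(k + N, N)` is the rising factorial `(N + 1) ⋯ (N + k)`; concatenating such factors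
only makes later ones larger. -/
theorem prod_choose_le (N : ℕ) {J : Type*} (s : Finset J) (k : J → ℕ) :
    ∏ j ∈ s, (k j + N).choose N ≤
      (∑ j ∈ s, k j).factorial * (∑ j ∈ s, k j + N).choose N := by
  have key : ∀ k, k.factorial * (k + N).choose N = (N + 1).ascFactorial k := by
    intro k
    rw [Nat.ascFactorial_eq_factorial_mul_choose, add_comm N k, ← Nat.choose_symm_add]
  rw [key]
  have h2 : ∏ j ∈ s, (k j + N).choose N ≤ ∏ j ∈ s, (N + 1).ascFactorial (k j) :=
    Finset.prod_le_prod' fun j _ => by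
      rw [← key]; exact Nat.le_mul_of_pos_left _ (Nat.factorial_pos _)
  refine h2.trans ?_
  classical
  induction s using Finset.induction_on with
  | empty => simp
  | insert j s hj ih =>
    rw [Finset.prod_insert hj, Finset.sum_insert hj, ← Nat.ascFactorial_mul_ascFactorial]
    refine Nat.mul_le_mul_left _ ((ih ?_).trans ?_)
    · exact Finset.prod_le_prod' fun j _ => by
        rw [← key]; exact Nat.le_mul_of_pos_left _ (Nat.factorial_pos _)
    · exact ascFactorial_le_ascFactorial (by omega) _

theorem choose_add_succ_mul (k N : ℕ) : (k + (N + 1)).choose (N + 1) * k =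
    (k + N).choose (N + 1) * (k + N + 1) := by
  rw [Nat.choose_mul_succ_eq, ← add_assoc, show k + N + 1 - (N + 1) = k by omega]

theorem choose_add_succ (k N : ℕ) :
    (k + (N + 1)).choose (N + 1) = (k + N).choose N + (k + N).choose (N + 1) := by
  rw [← add_assoc, Nat.choose_succ_succ]

end Binomials

/-! ### Choosing the delays -/

section Selection

/-- Change one factor at a time; the other factors are at most 1. -/
theorem prod_le_prod_add_sum {J : Type*} (s : Finset J) (X Y ε : J → ℝ) (hX : ∀ j ∈ s, 0 ≤ X j)
    (hX' : ∀ j ∈ s, X j ≤ 1)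
    (hY : ∀ j ∈ s, 0 ≤ Y j) (hY' : ∀ j ∈ s, Y j ≤ 1) (hε : ∀ j ∈ s, 0 ≤ ε j)
    (h : ∀ j ∈ s, Y j ≤ X j + ε j) :
    ∏ j ∈ s, Y j ≤ ∏ j ∈ s, X j + ∑ j ∈ s, ε j := by
  classical
  induction s using Finset.induction_on with
  | empty => simp
  | insert j s hj ih =>
    rw [Finset.prod_insert hj, Finset.prod_insert hj, Finset.sum_insert hj]
    simp only [Finset.forall_mem_insert] at hX hX' hY hY' hε h
    have h1 := ih hX.2 hX'.2 hY.2 hY'.2 hε.2 h.2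
    have h2 : ∏ j ∈ s, Y j ≤ 1 := Finset.prod_le_one hY.2 hY'.2
    have h3 : 0 ≤ ∏ j ∈ s, Y j := Finset.prod_nonneg hY.2
    have h4 : 0 ≤ ∑ j ∈ s, ε j := Finset.sum_nonneg hε.2
    calc Y j * ∏ j ∈ s, Y j ≤ (X j + ε j) * ∏ j ∈ s, Y j := by gcongr; exact h.1
      _ = X j * ∏ j ∈ s, Y j + ε j * ∏ j ∈ s, Y j := by ring
      _ ≤ X j * (∏ j ∈ s, X j + ∑ j ∈ s, ε j) + ε j * 1 := by
        gcongr
        · exact hX.1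
        · exact hε.1
      _ ≤ X j * ∏ j ∈ s, X j + 1 * ∑ j ∈ s, ε j + ε j * 1 := by
        rw [mul_add]; gcongr; exact hX'.1
      _ = _ := by ring

/-- Pigeonhole: `m` disjoint windows of length `L` start at 1, and the point `p` of delay 0 lies in
none, so they cannot all be occupied. -/
theorem exists_gap {m : ℕ} (a : Fin m → ℕ) (L : ℕ) (p : Fin m) (hp : a p = 0) :
    ∃ t, 0 < t ∧ t ≤ m * L + 1 ∧ ∀ q, a q < t ∨ t + L ≤ a q := by
  by_contra! hcon
  have h1 : ∀ j : Fin m, ∃ q, q ≠ p ∧ 1 + j * L ≤ a q ∧ a q < 1 + j * L + L := by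
    intro j
    have hj : (j : ℕ) * L ≤ m * L := Nat.mul_le_mul_right _ j.2.le
    obtain ⟨q, hq1, hq2⟩ := hcon (1 + j * L) (by omega) (by omega)
    refine ⟨q, ?_, hq1, hq2⟩
    rintro rfl
    omega
  choose f hf1 hf2 hf3 using h1
  have hinj : Function.Injective f := by
    intro i j hij
    by_contra hne
    rcases lt_or_gt_of_ne (Fin.val_ne_of_ne hne) with h | h
    · have h4 := hf3 i
      have h5 := hf2 j
      rw [hij] at h4
      have : ((i : ℕ) + 1) * L ≤ j * L := Nat.mul_le_mul_right _ h
      rw [add_mul] at this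
      omega
    · have h4 := hf3 j
      have h5 := hf2 i
      rw [hij] at h5
      have : ((j : ℕ) + 1) * L ≤ i * L := Nat.mul_le_mul_right _ h
      rw [add_mul] at this
      omega
  obtain ⟨i, hi⟩ := Finite.surjective_of_injective hinj p
  exact hf1 i hi

/-- A tâtonnement lemma: lowering the delay of a point raises its own values in small steps and
lowers the others', and any group of points processed well before the others gets a total value at
least `c`; hence the values can be made proportional to prescribed weights. -/
theorem exists_delay {m : ℕ} {T : Type*} (𝒯 : Fin m → Set T) (Q : Fin m → T → (Fin m → ℕ) → ℝ)
    (w : Fin m → ℝ) (hw : ∀ p, 0 ≤ w p) (hw1 : ∑ p, w p ≤ 1) (c ε : ℝ) (hc : 0 < c) (hε : 0 ≤ ε)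
    (hεc : m * ε < c / 2) (L : ℕ)
    (hother : ∀ a p q t, a p ≤ m * L + 1 → p ≠ q → 0 < a p →
      Q q t (Function.update a p (a p - 1)) ≤ Q q t a)
    (hself : ∀ a p t, t ∈ 𝒯 p → a p ≤ m * L + 1 → 0 < a p →
      Q p t (Function.update a p (a p - 1)) ≤ Q p t a + ε)
    (hgap : ∀ a (U : Finset (Fin m)) (t : Fin m → T), (∀ p, a p ≤ m * L + 1) → U.Nonempty →
      (∀ p ∈ U, ∀ q ∉ U, a p + L ≤ a q) → (∀ p ∈ U, t p ∈ 𝒯 p) → c ≤ ∑ p ∈ U, Q p (t p) a) :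
    ∃ a : Fin m → ℕ, (∀ p, a p ≤ m * L + 1) ∧ ∀ p, ∀ t ∈ 𝒯 p, c / 2 * w p ≤ Q p t a := by
  set M := m * L + 1 with hM
  -- Admissible: each point below the maximal delay has some value that is still small. Delay `M`
  -- everywhere is vacuously admissible; a configuration of least total delay is the one sought.
  let P : ℕ → Prop := fun σ => ∃ a : Fin m → ℕ, ∑ p, a p = σ ∧ (∀ p, a p ≤ M) ∧
    ∀ p, a p < M → ∃ t ∈ 𝒯 p, Q p t a ≤ c / 2 * w p + ε
  have hP : ∃ σ, P σ := ⟨_, fun _ => M, rfl, fun _ => le_rfl, fun p h => absurd h (lt_irrefl _)⟩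
  classical
  obtain ⟨a, hσ, haM, ha⟩ := Nat.find_spec hP
  refine ⟨a, haM, ?_⟩
  by_contra! hcon
  obtain ⟨p, t, ht, hpt⟩ := hcon
  -- If `p` falls short and can be lowered, lowering it stays admissible: its bad value rises by at
  -- most `ε`, the values of the others do not rise. This contradicts minimality.
  by_cases hp0 : 0 < a p
  · set a' := Function.update a p (a p - 1) with ha'
    have hle : ∀ q, a' q ≤ a q := by
      intro q
      by_cases hq : q = p
      · subst hq; simp [a']
      · simp [a', hq]
    have hlt : ∑ q, a' q < Nat.find hP := by
      rw [← hσ]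
      refine Finset.sum_lt_sum (fun q _ => hle q) ⟨p, Finset.mem_univ p, ?_⟩
      simp only [a', Function.update_self]; omega
    refine Nat.find_min hP hlt ⟨a', rfl, fun q => (hle q).trans (haM q), fun q hq => ?_⟩
    by_cases hqp : q = p
    · subst hqp
      exact ⟨t, ht, (hself a q t ht (haM q) hp0).trans (by linarith)⟩
    · have haq : a' q = a q := by simp [a', hqp]
      rw [haq] at hq
      obtain ⟨t', ht', h⟩ := ha q hq
      exact ⟨t', ht', (hother a p q t' (haM p) (Ne.symm hqp) hp0).trans h⟩
  -- If `p` already has delay 0, the points below a gap in the delays all have a small value, and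
  -- these sum to at most `c / 2 + m * ε < c`, against `hgap`.
  · obtain ⟨τ, hτ0, hτM, hτ⟩ := exists_gap a L p (by omega)
    let U : Finset (Fin m) := Finset.univ.filter fun q => a q < τ
    have hUlt : ∀ q ∈ U, a q < τ := fun q hq => (Finset.mem_filter.1 hq).2
    have hpU : p ∈ U := Finset.mem_filter.2 ⟨Finset.mem_univ p, by omega⟩
    have hex : ∀ q, ∃ t' : T, q ∈ U → t' ∈ 𝒯 q ∧ Q q t' a ≤ c / 2 * w q + ε := by
      intro q
      by_cases hq : q ∈ U
      · obtain ⟨t', h1, h2⟩ := ha q (lt_of_lt_of_le (hUlt q hq) hτM)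
        exact ⟨t', fun _ => ⟨h1, h2⟩⟩
      · exact ⟨t, fun h => absurd h hq⟩
    choose t' ht' using hex
    have h1 := hgap a U t' haM ⟨p, hpU⟩ (fun q hq r hr => by
      have := hUlt q hq
      have hr' : ¬ a r < τ := fun h => hr (Finset.mem_filter.2 ⟨Finset.mem_univ r, h⟩)
      rcases hτ r with h | h <;> omega) fun q hq => (ht' q hq).1
    have h2 : ∑ q ∈ U, Q q (t' q) a ≤ ∑ q ∈ U, (c / 2 * w q + ε) :=
      Finset.sum_le_sum fun q hq => (ht' q hq).2
    have h3 : ∑ q ∈ U, (c / 2 * w q + ε) ≤ ∑ q, (c / 2 * w q + ε) :=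
      Finset.sum_le_sum_of_subset_of_nonneg (Finset.subset_univ _) fun q _ _ => by
        have := hw q; positivity
    have h4 : ∑ q, (c / 2 * w q + ε) = c / 2 * ∑ q, w q + m * ε := by
      rw [Finset.sum_add_distrib, ← Finset.mul_sum]; simp
    have h5 : c / 2 * ∑ q, w q ≤ c / 2 * 1 := by gcongr
    linarith

end Selection

/-! ### Relative shares and the factorisation of the kernel -/

section Factorisation

open Module

section RelativeShares

variable {F : Type*} [Field F] {E : Type*} [AddCommGroup E] [Module F E] [FiniteDimensional F E]
  {m : ℕ}

/-- The share of a point on a plane, as a proportion of all the conditions on the plane. -/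
noncomputable def relShare (x : Fin m → E) (a : Fin m → ℕ) (N S : ℕ) (V : Submodule F E)
    (p : Fin m) : ℝ :=
  planeShare x a N S V p / ((finrank F V + N).choose N : ℕ)

theorem choose_finrank_pos {F E : Type*} [Field F] [AddCommGroup E] [Module F E]
    (V : Submodule F E) (N : ℕ) :
    (0 : ℝ) < ((finrank F V + N).choose N : ℕ) := by
  exact_mod_cast Nat.choose_pos (by omega)

theorem relShare_nonneg (x : Fin m → E) (a : Fin m → ℕ) (N S : ℕ) (V : Submodule F E)
    (p : Fin m) : 0 ≤ relShare x a N S V p := by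
  unfold relShare; positivity

theorem relShare_le_one (x : Fin m → E) (a : Fin m → ℕ) {N S : ℕ} (V : Submodule F E)
    {p : Fin m} (hS : N + 1 + a p ≤ S) : relShare x a N S V p ≤ 1 := by
  rw [relShare, div_le_one (choose_finrank_pos V N)]
  exact_mod_cast planeShare_le x a V hS

theorem relShare_mono_delay {x : Fin m → E} {a a' : Fin m → ℕ} {N S : ℕ} {V : Submodule F E}
    {p : Fin m} (h : ∀ q, a q ≤ a' q) (hp : a p = a' p) :
    relShare x a N S V p ≤ relShare x a' N S V p := by
  refine div_le_div_of_nonneg_right ?_ (choose_finrank_pos V N).le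
  exact_mod_cast planeShare_mono_delay h hp

/-- The growth is at most the proportion of polynomials of top degree, `C(k + N, N + 1) / C(k + N +
1, N + 1) = k / (k + N + 1)`. -/
theorem relShare_le_add {x : Fin m → E} (hx : Function.Injective x) {a a' : Fin m → ℕ} {N S : ℕ}
    (V : Submodule F E) {p : Fin m} (ha : ∀ q, q ≠ p → a' q = a q) (hap : a p = a' p + 1)
    (hS : N + 2 + a p ≤ S) :
    relShare x a' (N + 1) S V p ≤ relShare x a (N + 1) S V p + finrank F V / (N + 1 : ℝ) := by
  have h2 := planeShare_le_add hx V ha hap hS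
  have h3 := choose_add_succ (finrank F V) N
  have h4 := choose_add_succ_mul (finrank F V) N
  have h5 : (((finrank F V + N).choose (N + 1) : ℕ) : ℝ) * (N + 1) ≤
      finrank F V * ((finrank F V + (N + 1)).choose (N + 1) : ℕ) := by
    have : (finrank F V + N).choose (N + 1) * (N + 1) ≤
        finrank F V * (finrank F V + (N + 1)).choose (N + 1) := by
      rw [mul_comm (finrank F V), h4]
      exact Nat.mul_le_mul_left _ (by omega)
    exact_mod_cast this
  have h6 : planeShare x a' (N + 1) S V p ≤
      planeShare x a (N + 1) S V p + (finrank F V + N).choose (N + 1) := by omega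
  have h7 : (planeShare x a' (N + 1) S V p : ℝ) ≤
      planeShare x a (N + 1) S V p + ((finrank F V + N).choose (N + 1) : ℕ) := by
    exact_mod_cast h6
  have hd := choose_finrank_pos V (N + 1)
  refine (div_le_div_of_nonneg_right h7 hd.le).trans ?_
  rw [add_div, relShare]
  refine add_le_add le_rfl ?_
  rw [div_le_div_iff₀ hd (by positivity)]
  exact h5

theorem planeShare_top_le_mul_prod_relShare (x : Fin m → E) (a : Fin m → ℕ) {N S d : ℕ}
    {V : Fin d → Submodule F E} (hV : ⨆ j, V j = ⊤) (hk : ∑ j, finrank F (V j) = finrank F E)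
    {p : Fin m} (hS : N + 1 + a p ≤ S) :
    (planeShare x a N S (⊤ : Submodule F E) p : ℝ) ≤
      ((finrank F E).factorial * ((finrank F E + N).choose N : ℕ)) *
        ∏ j, relShare x a N S (V j) p := by
  have h4 := planeShare_top_le_prod x a hV hk hS
  have h5 := prod_choose_le N Finset.univ fun j => finrank F (V j)
  rw [hk] at h5
  simp only [relShare]
  rw [Finset.prod_div_distrib]
  have h6 : (0 : ℝ) < ∏ j, (((finrank F (V j) + N).choose N : ℕ) : ℝ) :=
    Finset.prod_pos fun j _ => choose_finrank_pos _ _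
  rw [mul_div_assoc', le_div_iff₀ h6]
  have h7 : planeShare x a N S (⊤ : Submodule F E) p * ∏ j, (finrank F (V j) + N).choose N ≤
      ((finrank F E).factorial * (finrank F E + N).choose N) *
        ∏ j, planeShare x a N S (V j) p := by
    rw [mul_comm]
    exact Nat.mul_le_mul h5 h4
  exact_mod_cast h7

/-- The group `U` gets the whole `C(n + N, N)` of shares in the space, and each of these is at most
`n! * C(n + N, N)` times the product of relative shares. -/
theorem inv_factorial_le_sum_of_gap (x : Fin m → E) (a : Fin m → ℕ) {N S d : ℕ}
    {U : Finset (Fin m)} {V : Fin m → Fin d → Submodule F E} (hS : ∀ p, N + 1 + a p ≤ S)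
    (hUne : U.Nonempty) (hU : ∀ p ∈ U, ∀ q ∉ U, a p + (N + 1) ≤ a q)
    (hV : ∀ p ∈ U, ⨆ j, V p j = ⊤ ∧ ∑ j, finrank F (V p j) = finrank F E) :
    1 / ((finrank F E).factorial : ℝ) ≤ ∑ p ∈ U, ∏ j, relShare x a N S (V p j) p := by
  obtain ⟨q, hq⟩ := hUne
  have h1 := sum_planeShare_top_of_gap (F := F) x a (N := N) (S := S) (U := U) (q := q)
    (fun v hv => by have := hU q hq v hv; omega) (hS q)
  have hfac : (0 : ℝ) < (finrank F E).factorial := by exact_mod_cast Nat.factorial_pos _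
  have hpos : (0 : ℝ) < ((finrank F E + N).choose N : ℕ) := by
    exact_mod_cast Nat.choose_pos (by omega)
  have h4 := Finset.sum_le_sum fun p hp =>
    planeShare_top_le_mul_prod_relShare x a (hV p hp).1 (hV p hp).2 (hS p)
  rw [← Nat.cast_sum, h1, ← Finset.mul_sum] at h4
  rw [div_le_iff₀' hfac]
  refine le_of_mul_le_mul_left ?_ hpos
  calc _ = _ := mul_one _
    _ ≤ _ := h4
    _ = _ := by ring

/-- For a suitable choice of delays, the relative shares have products that dominate prescribed
weights. -/
theorem exists_prod_relShare_ge (d : ℕ) {x : Fin m → E} (hx : Function.Injective x)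
    (w : Fin m → ℝ) (hw : ∀ p, 0 ≤ w p) (hw1 : ∑ p, w p ≤ 1) :
    ∃ (a : Fin m → ℕ) (N S : ℕ), (∀ p, N + 1 + a p ≤ S) ∧
      ∀ (p : Fin m) (V : Fin d → Submodule F E), ⨆ j, V j = ⊤ →
        ∑ j, finrank F (V j) = finrank F E →
        w p ≤ 2 * (finrank F E).factorial * ∏ j, relShare x a N S (V j) p := by
  set n := finrank F E with hn
  -- This makes `m` increments `n / (N + 1)` together smaller than half of `1 / n!`. The degree used
  -- is `N + 1`, so a gap of `N + 2` suffices.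
  obtain ⟨N, hN⟩ : ∃ N, N = 2 * m * n * n.factorial := ⟨_, rfl⟩
  have hfac : (0 : ℝ) < n.factorial := by exact_mod_cast n.factorial_pos
  have hother : ∀ a p q (V : Fin d → Submodule F E), a p ≤ m * (N + 2) + 1 → p ≠ q → 0 < a p →
      ∏ j, relShare x (Function.update a p (a p - 1)) (N + 1) (N + 2 + (m * (N + 2) + 1)) (V j) q ≤
        ∏ j, relShare x a (N + 1) (N + 2 + (m * (N + 2) + 1)) (V j) q := by
    intro a p q V _ hpq _
    refine Finset.prod_le_prod (fun j _ => relShare_nonneg _ _ _ _ _ _) fun j _ =>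
      relShare_mono_delay (fun r => ?_) (by simp [hpq.symm])
    by_cases hr : r = p
    · subst hr; simp
    · simp [hr]
  have hself : ∀ a p (V : Fin d → Submodule F E),
      V ∈ {V : Fin d → Submodule F E | ⨆ j, V j = ⊤ ∧ ∑ j, finrank F (V j) = n} →
      a p ≤ m * (N + 2) + 1 → 0 < a p →
      ∏ j, relShare x (Function.update a p (a p - 1)) (N + 1) (N + 2 + (m * (N + 2) + 1)) (V j) p ≤
        ∏ j, relShare x a (N + 1) (N + 2 + (m * (N + 2) + 1)) (V j) p + n / (N + 1 : ℝ) := by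
    rintro a p V ⟨_, hk⟩ ha hp
    have h1 : ∑ j, ((finrank F (V j) : ℝ) / (N + 1)) = n / (N + 1) := by
      rw [← Finset.sum_div, ← hk]; push_cast; rfl
    rw [← h1]
    refine prod_le_prod_add_sum _ _ _ _ (fun j _ => relShare_nonneg _ _ _ _ _ _)
      (fun j _ => relShare_le_one _ _ _ (by omega)) (fun j _ => relShare_nonneg _ _ _ _ _ _)
      (fun j _ => relShare_le_one _ _ _ (by rw [Function.update_self]; omega))
      (fun j _ => by positivity) fun j _ => ?_
    exact relShare_le_add hx (V j) (fun q hq => by simp [hq]) (by simp; omega) (by omega)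
  obtain ⟨a, haM, ha⟩ := exists_delay (T := Fin d → Submodule F E)
    (fun _ => {V | ⨆ j, V j = ⊤ ∧ ∑ j, finrank F (V j) = n})
    (fun p V a => ∏ j, relShare x a (N + 1) (N + 2 + (m * (N + 2) + 1)) (V j) p) w hw hw1
    (1 / n.factorial) (n / (N + 1 : ℝ)) (by positivity) (by positivity)
    (by
      rw [← mul_div_assoc, div_div, div_lt_div_iff₀ (by positivity) (by positivity), one_mul]
      have : ((N : ℕ) : ℝ) = 2 * m * n * n.factorial := by rw [hN]; push_cast; ring
      rw [this]; linarith) (N + 2) hother hself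
    (fun a U V haM hne hU hV => inv_factorial_le_sum_of_gap x a
      (fun p => by have := haM p; omega) hne hU hV)
  refine ⟨a, N + 1, N + 2 + (m * (N + 2) + 1), fun p => by have := haM p; omega,
    fun p V hV hk => ?_⟩
  have h := ha p V ⟨hV, hk⟩
  have h2 : 1 / (n.factorial : ℝ) / 2 * w p = w p / (2 * n.factorial) := by
    field_simp
  rw [h2, div_le_iff₀' (by positivity)] at h
  exact h

end RelativeShares

variable {𝔽 : Type*} [Field 𝔽] {n d : ℕ} {k : Fin d → ℕ}

open Classical in
theorem multijointKernel_eq (p : Fin n → 𝔽) (π : ∀ j, KPlane 𝔽 (k j) n) :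
    multijointKernel p π =
      if (∀ j, p ∈ (π j).carrier) ∧ ⨆ j, (π j).carrier.direction = ⊤ then 1 else 0 := by
  have h1 : ∏ j, Set.indicator ((π j).carrier : Set (Fin n → 𝔽)) (fun _ => (1 : ℝ≥0)) p =
      if ∀ j, p ∈ (π j).carrier then 1 else 0 := by
    split_ifs with h
    · exact Finset.prod_eq_one fun j _ => Set.indicator_of_mem (h j) _
    · push Not at h
      obtain ⟨j, hj⟩ := h
      exact Finset.prod_eq_zero (Finset.mem_univ j) (Set.indicator_of_notMem hj _)
  rw [multijointKernel, h1, discreteWedge]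
  by_cases h2 : ∀ j, p ∈ (π j).carrier <;>
    by_cases h3 : ⨆ j, (π j).carrier.direction = ⊤ <;> simp [KPlane.e, h2, h3]

theorem sum_eq_one_of_dNorm {X : Type*} (hd : d ≠ 0) {S : X → ℝ≥0} (h : dNorm d S = 1) :
    ∑' p, S p ^ d = 1 := by
  have hd' : (1 / (d : ℝ)) ≠ 0 := by positivity
  exact NNReal.rpow_left_injective hd' (h.trans (NNReal.one_rpow _).symm)

theorem exists_factorisation (hd : d ≠ 0) (hk : ∑ j, k j = n) (P : ∀ j, Set (KPlane 𝔽 (k j) n))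
    (S : multijoints P → ℝ≥0) (hS : (Function.support S).Finite) (hS1 : dNorm d S = 1) :
    ∃ s : ∀ κ : ℕ, multijoints P → Gr 𝔽 κ n → ℝ≥0,
      (∀ (p : multijoints P) (π : ∀ j, KPlane 𝔽 (k j) n), (∀ j, π j ∈ P j) →
        multijointKernel p.1 π * S p ^ d ≤ (2 * n.factorial) * ∏ j, s (k j) p (π j).e) ∧
      (∀ j, ∀ π ∈ P j, (∃ p ∈ multijoints P, p ∈ π.carrier) →
        HasSum (fun p : {p : multijoints P // p.1 ∈ π.carrier} => s (k j) p.1 π.e) 1) := by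
  classical
  have hfin : Fintype (Function.support S) := hS.fintype
  obtain ⟨m, ⟨e⟩⟩ := Finite.exists_equiv_fin (Function.support S)
  let x : Fin m → Fin n → 𝔽 := fun i => (e.symm i).1.1
  have hx : Function.Injective x :=
    Subtype.val_injective.comp (Subtype.val_injective.comp e.symm.injective)
  have hsum : ∑ i, ((S (e.symm i).1 ^ d : ℝ≥0) : ℝ) ≤ 1 := by
    have h1 := sum_eq_one_of_dNorm hd hS1
    rw [tsum_eq_sum (s := hS.toFinset) (fun p hp => by
      have : S p = 0 := by simpa using hp
      rw [this, zero_pow hd])] at h1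
    have h2 : ∑ i, S (e.symm i).1 ^ d = ∑ p ∈ hS.toFinset, S p ^ d := by
      rw [e.symm.sum_comp (fun q : Function.support S => S q.1 ^ d)]
      rw [← Finset.sum_coe_sort hS.toFinset]
      exact Fintype.sum_equiv (Equiv.subtypeEquivRight fun p => by simp) _ _ fun _ => rfl
    rw [← NNReal.coe_sum, h2, h1, NNReal.coe_one]
  obtain ⟨a, N, Z, hZ, hmain⟩ := exists_prod_relShare_ge (F := 𝔽) d hx
    (fun i => ((S (e.symm i).1 ^ d : ℝ≥0) : ℝ)) (fun i => NNReal.coe_nonneg _) hsum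
  -- One chosen multijoint in each coset of `V` that contains any.
  let rep : ∀ (V : Submodule 𝔽 (Fin n → 𝔽)), (multijoints P) → Prop := fun V p =>
    ∃ _ : Nonempty (multijoints P),
      Function.invFun (fun q : multijoints P => V.mkQ q.1) (V.mkQ p.1) = p
  -- Off the support the pointwise bound is trivial and only the normalisation matters: a plane that
  -- misses the support puts its unit mass on its chosen multijoint. All cases depend only on the
  -- point and the direction.
  let s : ∀ κ : ℕ, multijoints P → Gr 𝔽 κ n → ℝ≥0 := fun κ p V =>
    if h : p ∈ Function.support S then
      (planeShare x a N Z V.1 (e ⟨p, h⟩) : ℝ≥0) / ((κ + N).choose N : ℕ)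
    else if ∃ q ∈ Function.support S, q.1 - p.1 ∈ V.1 then 0
    else if rep V.1 p then 1 else 0
  refine ⟨s, fun p π hπ => ?_, fun j π hπ hJ => ?_⟩
  · rw [multijointKernel_eq]
    split_ifs with h
    · by_cases hp : p ∈ Function.support S
      · have hfr : ∀ j, finrank 𝔽 (π j).carrier.direction = k j := fun j =>
          (π j).finrank_direction
        have h1 := hmain (e ⟨p, hp⟩) (fun j => (π j).carrier.direction) h.2 (by
          simp only [hfr, hk, finrank_fin_fun])
        simp only [Equiv.symm_apply_apply, finrank_fin_fun] at h1
        rw [one_mul, ← NNReal.coe_le_coe]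
        refine h1.trans (le_of_eq ?_)
        push_cast
        congr 1
        refine Finset.prod_congr rfl fun j _ => ?_
        simp only [s, dif_pos hp, KPlane.e, relShare, hfr]
        push_cast
        rfl
      · have : S p = 0 := by simpa using hp
        rw [this, zero_pow hd, mul_zero]
        exact zero_le
    · rw [zero_mul]; exact zero_le
  · have hmem : ∀ q p : multijoints P, p.1 ∈ π.carrier →
        (q.1 - p.1 ∈ π.carrier.direction ↔ q.1 ∈ π.carrier) := by
      intro q p hp
      rw [← vsub_eq_sub, AffineSubspace.vsub_right_mem_direction_iff_mem hp]
    suffices h : HasSum ({p : multijoints P | p.1 ∈ π.carrier}.indicator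
        fun p => s (k j) p π.e) 1 from hasSum_subtype_iff_indicator.2 h
    by_cases hq : ∃ q ∈ Function.support S, q.1 ∈ π.carrier
    · obtain ⟨q, hqS, hq⟩ := hq
      have h1 := sum_planeShare (F := 𝔽) x a (N := N) (S := Z) π.carrier.direction
        (u := q.1) (q := e ⟨q, hqS⟩) (by simp [x]) (hZ _)
      rw [π.finrank_direction] at h1
      have h0 : ∀ p ∉ hS.toFinset, ({p : multijoints P | p.1 ∈ π.carrier}.indicator
        fun p => s (k j) p π.e) p = 0 := by
        intro p hp
        rw [Set.Finite.mem_toFinset] at hp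
        rw [Set.indicator_apply_eq_zero]
        intro hpπ
        simp only [s]
        rw [dif_neg hp, if_pos ⟨q, hqS, (hmem q p hpπ).2 hq⟩]
      have h2 : HasSum _ _ := hasSum_sum_of_ne_finset_zero (L := SummationFilter.unconditional _) h0
      convert h2 using 1
      rw [← Finset.sum_coe_sort hS.toFinset]
      have hD : (((k j + N).choose N : ℕ) : ℝ≥0) ≠ 0 := by
        exact_mod_cast (Nat.choose_pos (by omega)).ne'
      have h3 : (1 : ℝ≥0) = ∑ i, ((if x i - q.1 ∈ π.carrier.direction then
          planeShare x a N Z π.carrier.direction i else 0 : ℕ) : ℝ≥0) /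
            ((k j + N).choose N : ℕ) := by
        rw [← Finset.sum_div, ← Nat.cast_sum, h1, div_self hD]
      rw [h3]
      refine Fintype.sum_equiv (e.symm.trans (Equiv.subtypeEquivRight fun p => by simp)) _ _
        fun i => ?_
      set p := e.symm i with hp
      have hi : e p = i := e.apply_symm_apply i
      change _ = ({p : multijoints P | p.1 ∈ π.carrier}.indicator
        (fun p => s (k j) p π.e) p.1 : ℝ≥0)
      have hxi : x i = p.1.1 := rfl
      by_cases hpπ : p.1.1 ∈ π.carrier
      · rw [Set.indicator_of_mem (s := {p : multijoints P | p.1 ∈ π.carrier}) hpπ,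
          if_pos (by rw [hxi]; exact (hmem p.1 q hq).2 hpπ)]
        simp only [s, KPlane.e]
        rw [dif_pos p.2, hi]
      · rw [Set.indicator_of_notMem (s := {p : multijoints P | p.1 ∈ π.carrier}) hpπ,
          if_neg (by rw [hxi]; exact fun h => hpπ ((hmem p.1 q hq).1 h)), Nat.cast_zero, zero_div]
    · push Not at hq
      obtain ⟨p₁, hp₁, hp₁π⟩ := hJ
      have hne : Nonempty (multijoints P) := ⟨⟨p₁, hp₁⟩⟩
      set f : multijoints P → (Fin n → 𝔽) ⧸ π.carrier.direction :=
        fun q => π.carrier.direction.mkQ q.1 with hf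
      have hfiff : ∀ q p : multijoints P, p.1 ∈ π.carrier → (f q = f p ↔ q.1 ∈ π.carrier) := by
        intro q p hp
        rw [← hmem q p hp]
        exact Submodule.Quotient.eq _
      have hp₀ : f (Function.invFun f (f ⟨p₁, hp₁⟩)) = f ⟨p₁, hp₁⟩ :=
        Function.invFun_eq ⟨⟨p₁, hp₁⟩, rfl⟩
      set p₀ := Function.invFun f (f ⟨p₁, hp₁⟩) with hp₀def
      have hp₀π := (hfiff p₀ ⟨p₁, hp₁⟩ hp₁π).1 hp₀
      convert hasSum_ite_eq p₀ (1 : ℝ≥0) using 1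
      funext p
      by_cases hpπ : p.1 ∈ π.carrier
      · rw [Set.indicator_of_mem (s := {p : multijoints P | p.1 ∈ π.carrier}) hpπ]
        have hpS : p ∉ Function.support S := fun h => hq p h hpπ
        have hpS' : ¬ ∃ q ∈ Function.support S, q.1 - p.1 ∈ π.carrier.direction := by
          rintro ⟨q, hqS, h⟩
          exact hq q hqS ((hmem q p hpπ).1 h)
        have hrep : rep π.carrier.direction p ↔ p = p₀ := by
          have h1 : f p = f ⟨p₁, hp₁⟩ := (hfiff p ⟨p₁, hp₁⟩ hp₁π).2 hpπ
          constructor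
          · rintro ⟨_, h⟩
            change Function.invFun f (f p) = p at h
            rw [← h, h1]
          · intro h
            refine ⟨hne, ?_⟩
            change Function.invFun f (f p) = p
            rw [h1, h]
        simp only [s, KPlane.e]
        rw [dif_neg hpS, if_neg hpS', if_congr hrep rfl rfl]
      · rw [Set.indicator_of_notMem (s := {p : multijoints P | p.1 ∈ π.carrier}) hpπ,
          if_neg]
        rintro rfl
        exact hpπ hp₀π

end Factorisation

/-! ### From the factorisation to the multijoint inequality -/

section Inequality

/-- A finite set of tuples lies in the box of its projections, over which the sum factorises. -/
theorem ENNReal.tsum_prod_le_prod_tsum {d : ℕ} {X : Fin d → Type*} (g : ∀ j, X j → ℝ≥0∞) :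
    ∑' π : ∀ j, X j, ∏ j, g j (π j) ≤ ∏ j, ∑' x, g j x := by
  classical
  rw [ENNReal.tsum_eq_iSup_sum]
  refine iSup_le fun A => ?_
  calc ∑ π ∈ A, ∏ j, g j (π j)
      ≤ ∑ π ∈ Fintype.piFinset fun j => A.image fun π => π j, ∏ j, g j (π j) :=
        Finset.sum_le_sum_of_subset fun π hπ => Fintype.mem_piFinset.2 fun j =>
          Finset.mem_image_of_mem _ hπ
    _ = ∏ j, ∑ x ∈ A.image fun π => π j, g j x := (Finset.prod_univ_sum _ _).symm
    _ ≤ ∏ j, ∑' x, g j x := Finset.prod_le_prod' fun j _ => ENNReal.sum_le_tsum _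

/-- Hölder with `d` equal exponents, for counting measure. -/
theorem ENNReal.sum_prod_rpow_le {X : Type*} (A : Finset X) {d : ℕ} (hd : d ≠ 0)
    (g : Fin d → X → ℝ≥0∞) :
    ∑ p ∈ A, ∏ j, g j p ^ (1 / (d : ℝ)) ≤ ∏ j, (∑ p ∈ A, g j p) ^ (1 / (d : ℝ)) := by
  let _ : MeasurableSpace A := ⊤
  have h := ENNReal.lintegral_prod_norm_pow_le (μ := MeasureTheory.Measure.count) (α := A)
    Finset.univ (f := fun (j : Fin d) (p : A) => g j p)
    (fun _ _ => (measurable_from_top).aemeasurable) (p := fun _ => 1 / (d : ℝ))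
    (by simp [hd]) (fun _ _ => by positivity)
  simp only [MeasureTheory.lintegral_count, tsum_fintype] at h
  rw [Finset.sum_coe_sort A (fun p => ∏ j, g j p ^ (1 / (d : ℝ)))] at h
  refine h.trans (le_of_eq (Finset.prod_congr rfl fun j _ => ?_))
  rw [Finset.sum_coe_sort A (g j)]

variable {𝔽 : Type*} [Field 𝔽] {n d : ℕ} {k : Fin d → ℕ}

theorem multijointKernel_le_one (p : Fin n → 𝔽) (π : ∀ j, KPlane 𝔽 (k j) n) :
    multijointKernel p π ≤ 1 := by
  classical
  rw [multijointKernel_eq]; split_ifs <;> simp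

theorem multijointOperator_le (P : ∀ j, Set (KPlane 𝔽 (k j) n)) (f : ∀ j, P j → ℝ≥0)
    (p : Fin n → 𝔽) : multijointOperator P f p ≤ ∏ j, ∑' π : P j, (f j π : ℝ≥0∞) := by
  refine le_trans (ENNReal.tsum_le_tsum fun π => ?_)
    (ENNReal.tsum_prod_le_prod_tsum fun j (π : P j) => (f j π : ℝ≥0∞))
  rw [← ENNReal.ofNNReal_finsetProd, ENNReal.coe_le_coe]
  exact mul_le_of_le_one_left zero_le (multijointKernel_le_one _ _)

theorem multijointOperator_eq_zero {P : ∀ j, Set (KPlane 𝔽 (k j) n)} {p : Fin n → 𝔽}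
    (hp : p ∉ multijoints P) (f : ∀ j, P j → ℝ≥0) : multijointOperator P f p = 0 := by
  classical
  refine ENNReal.tsum_eq_zero.2 fun π => ?_
  have h : multijointKernel p (fun j => (π j).1) = 0 := by
    by_contra h0
    refine hp ⟨fun j => (π j).1, fun j => (π j).2, ?_⟩
    rw [multijointKernel_eq] at h0 ⊢
    split_ifs at h0 ⊢ <;> simp_all
  rw [h, zero_mul, ENNReal.coe_zero]

theorem le_mul_of_rpow_le {Λ C B : ℝ≥0∞} (hd : 2 ≤ d) (hΛ0 : Λ ≠ 0) (hΛ : Λ ≠ ⊤) (hC : 1 ≤ C)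
    (h : Λ ≤ (C * Λ * B) ^ (1 / (d : ℝ))) : Λ ≤ C * B ^ (1 / ((d : ℝ) - 1)) := by
  have hd' : (2 : ℝ) ≤ d := by exact_mod_cast hd
  have h1 : Λ ^ (d : ℝ) ≤ C * Λ * B := by
    rw [← ENNReal.le_rpow_inv_iff (by linarith), ← one_div]; exact h
  have h2 : Λ ^ (d : ℝ) = Λ * Λ ^ ((d : ℝ) - 1) := by
    rw [show (d : ℝ) = 1 + ((d : ℝ) - 1) by ring, ENNReal.rpow_add _ _ hΛ0 hΛ, ENNReal.rpow_one]
    ring_nf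
  rw [h2, mul_comm C Λ, mul_assoc, ENNReal.mul_le_mul_iff_right hΛ0 hΛ] at h1
  have h3 : Λ ≤ (C * B) ^ (1 / ((d : ℝ) - 1)) := by
    rw [one_div, ENNReal.le_rpow_inv_iff (by linarith)]; exact h1
  rw [ENNReal.mul_rpow_of_nonneg _ _ (by apply one_div_nonneg.2; linarith)] at h3
  refine h3.trans ?_
  gcongr
  conv_rhs => rw [← ENNReal.rpow_one C]
  -- Since `C ≥ 1` and `1 / (d - 1) ≤ 1`, the power of `C` is absorbed into `C`.
  refine ENNReal.rpow_le_rpow_of_exponent_le hC ?_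
  rw [div_le_one (by linarith)]; linarith

open Classical in
/-- A factorisation of the multijoint kernel yields a pointwise bound for the multijoint
operator. -/
theorem multijointOperator_mul_le {P : ∀ j, Set (KPlane 𝔽 (k j) n)} {C σ : ℝ≥0}
    {p : multijoints P} {s : ∀ κ : ℕ, multijoints P → Gr 𝔽 κ n → ℝ≥0}
    (h : ∀ (π : ∀ j, KPlane 𝔽 (k j) n), (∀ j, π j ∈ P j) →
      multijointKernel p.1 π * σ ≤ C * ∏ j, s (k j) p (π j).e) (f : ∀ j, P j → ℝ≥0) :
    multijointOperator P f p.1 * σ ≤ C * ∏ j, ∑' π : P j,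
      ((if p.1 ∈ π.1.carrier then s (k j) p π.1.e * f j π else 0 : ℝ≥0) : ℝ≥0∞) := by
  rw [multijointOperator, ← ENNReal.tsum_mul_right]
  refine le_trans ?_ (mul_le_mul_right (ENNReal.tsum_prod_le_prod_tsum _) _)
  rw [← ENNReal.tsum_mul_left]
  refine ENNReal.tsum_le_tsum fun π => ?_
  rw [← ENNReal.coe_mul, ← ENNReal.ofNNReal_finsetProd, ← ENNReal.coe_mul, ENNReal.coe_le_coe]
  by_cases hp : ∀ j, p.1 ∈ (π j).1.carrier
  · rw [mul_right_comm]
    calc _ ≤ (C * ∏ j, s (k j) p (π j).1.e) * ∏ j, f j (π j) := by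
          refine mul_le_mul_left ?_ _
          exact h (fun j => (π j).1) fun j => (π j).2
      _ = _ := by
          rw [mul_assoc, ← Finset.prod_mul_distrib]
          simp only [hp, if_true]
  · rw [multijointKernel_eq, if_neg (fun h => hp h.1), zero_mul, zero_mul]
    exact zero_le

open Classical in
theorem sum_tsum_le_of_hasSum {P : ∀ j, Set (KPlane 𝔽 (k j) n)}
    {s : ∀ κ : ℕ, multijoints P → Gr 𝔽 κ n → ℝ≥0}
    (h : ∀ j, ∀ π ∈ P j, (∃ p ∈ multijoints P, p ∈ π.carrier) →
      HasSum (fun p : {p : multijoints P // p.1 ∈ π.carrier} => s (k j) p.1 π.e) 1)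
    (f : ∀ j, P j → ℝ≥0) (A : Finset (multijoints P)) (j : Fin d) :
    ∑ p ∈ A, ∑' π : P j,
      ((if p.1 ∈ π.1.carrier then s (k j) p π.1.e * f j π else 0 : ℝ≥0) : ℝ≥0∞) ≤
        ∑' π : P j, (f j π : ℝ≥0∞) := by
  rw [← Summable.tsum_finsetSum fun _ _ => ENNReal.summable]
  refine ENNReal.tsum_le_tsum fun π => ?_
  rw [← ENNReal.ofNNReal_finsetSum, ENNReal.coe_le_coe, ← Finset.sum_filter, ← Finset.sum_mul]
  refine mul_le_of_le_one_left zero_le ?_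
  by_cases hπ : ∃ p ∈ multijoints P, p ∈ π.1.carrier
  · have h1 := h j π.1 π.2 hπ
    have h2 : HasSum ({p : multijoints P | p.1 ∈ π.1.carrier}.indicator
        fun p => s (k j) p π.1.e) 1 := hasSum_subtype_iff_indicator.1 h1
    calc _ = ∑ p ∈ A.filter fun p => p.1 ∈ π.1.carrier,
          {p : multijoints P | p.1 ∈ π.1.carrier}.indicator (fun p => s (k j) p π.1.e) p :=
          Finset.sum_congr rfl fun p hp =>
            (Set.indicator_of_mem (s := {p : multijoints P | p.1 ∈ π.1.carrier})
              (Finset.mem_filter.1 hp).2 _).symm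
      _ ≤ 1 := sum_le_hasSum _ (fun _ _ => zero_le) h2
  · rw [Finset.filter_false_of_mem fun p _ hp => hπ ⟨p.1, p.2, hp⟩]
    simp

theorem multijoint_inequality (hd : 2 ≤ d) {C : ℝ≥0} (hC : 1 ≤ C)
    {P : ∀ j, Set (KPlane 𝔽 (k j) n)}
    (hP : ∀ S : multijoints P → ℝ≥0, (Function.support S).Finite → dNorm d S = 1 →
      ∃ s : ∀ κ : ℕ, multijoints P → Gr 𝔽 κ n → ℝ≥0,
        (∀ (p : multijoints P) (π : ∀ j, KPlane 𝔽 (k j) n), (∀ j, π j ∈ P j) →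
          multijointKernel p.1 π * S p ^ d ≤ C * ∏ j, s (k j) p (π j).e) ∧
        (∀ j, ∀ π ∈ P j, (∃ p ∈ multijoints P, p ∈ π.carrier) →
          HasSum (fun p : {p : multijoints P // p.1 ∈ π.carrier} => s (k j) p.1 π.e) 1))
    (f : ∀ j, P j → ℝ≥0) :
    ∑' p : Fin n → 𝔽, multijointOperator P f p ^ (1 / ((d : ℝ) - 1)) ≤
      (C : ℝ≥0∞) * ∏ j, (∑' π : P j, (f j π : ℝ≥0∞)) ^ (1 / ((d : ℝ) - 1)) := by
  classical
  have hd' : (2 : ℝ) ≤ d := by exact_mod_cast hd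
  have hd0 : d ≠ 0 := by omega
  set θ : ℝ := 1 / ((d : ℝ) - 1) with hθdef
  have hθ : 0 < θ := by apply one_div_pos.2; linarith
  set B := ∏ j, ∑' π : P j, (f j π : ℝ≥0∞) with hB
  by_cases h0 : ∃ j, ∑' π : P j, (f j π : ℝ≥0∞) = 0
  -- A vanishing factor makes the product 0 even beside infinite ones, and then the operator
  -- vanishes too.
  · obtain ⟨j, hj⟩ := h0
    have hB0 : B = 0 := Finset.prod_eq_zero (Finset.mem_univ j) hj
    have : ∀ p, multijointOperator P f p = 0 := fun p =>
      le_antisymm (hB0 ▸ multijointOperator_le P f p) zero_le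
    simp [this, hθ]
  push Not at h0
  rw [ENNReal.prod_rpow_of_nonneg hθ.le]
  change _ ≤ (C : ℝ≥0∞) * B ^ θ
  by_cases hBtop : B = ⊤
  · rw [hBtop, ENNReal.top_rpow_of_pos hθ, ENNReal.mul_top]
    · exact le_top
    · exact ENNReal.coe_ne_zero.2 (by positivity)
  set T := multijointOperator P f with hT
  have hTtop : ∀ p, T p ≠ ⊤ := fun p => ne_top_of_le_ne_top hBtop (multijointOperator_le P f p)
  have hsupp : Function.support (fun p => T p ^ θ) ⊆ multijoints P := by
    intro p hp
    by_contra hpJ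
    exact hp (by simp [hT, multijointOperator_eq_zero hpJ, hθ])
  rw [← tsum_subtype_eq_of_support_subset hsupp, ENNReal.tsum_eq_iSup_sum]
  refine iSup_le fun A => ?_
  set Λ := ∑ p ∈ A, T p.1 ^ θ with hΛdef
  by_cases hΛ0 : Λ = 0
  · rw [hΛ0]; exact zero_le
  have hTθ : ∀ p, T p ^ θ ≠ ⊤ := fun p => ENNReal.rpow_ne_top_of_nonneg hθ.le (hTtop p)
  have hΛ : Λ ≠ ⊤ := ENNReal.sum_ne_top.2 fun p _ => hTθ _
  -- The extremal test function: `S ^ d` is `T ^ θ` normalised on the finite set `A`.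
  let S : multijoints P → ℝ≥0 := fun p =>
    if p ∈ A then (T p.1 ^ θ / Λ).toNNReal ^ (1 / (d : ℝ)) else 0
  have hSd : ∀ p ∈ A, ((S p ^ d : ℝ≥0) : ℝ≥0∞) = T p.1 ^ θ / Λ := by
    intro p hp
    simp only [S, if_pos hp]
    rw [one_div, NNReal.rpow_inv_natCast_pow _ hd0, ENNReal.coe_toNNReal]
    exact ENNReal.div_ne_top (hTθ _) hΛ0
  have hS0 : ∀ p ∉ A, S p = 0 := fun p hp => if_neg hp
  have hSsum : ∑' p, S p ^ d = 1 := by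
    rw [tsum_eq_sum (s := A) fun p hp => by rw [hS0 p hp, zero_pow hd0]]
    rw [← ENNReal.coe_inj, ENNReal.ofNNReal_finsetSum, Finset.sum_congr rfl hSd]
    simp only [div_eq_mul_inv]
    rw [← Finset.sum_mul, ENNReal.coe_one]
    exact ENNReal.mul_inv_cancel hΛ0 hΛ
  obtain ⟨s, hs1, hs2⟩ := hP S (A.finite_toSet.subset fun p hp => by
    by_contra h; exact hp (hS0 p h)) (by rw [dNorm, hSsum, NNReal.one_rpow])
  let g : Fin d → multijoints P → ℝ≥0∞ := fun j p => ∑' π : P j,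
    ((if p.1 ∈ π.1.carrier then s (k j) p π.1.e * f j π else 0 : ℝ≥0) : ℝ≥0∞)
  have hpt : ∀ p ∈ A, T p.1 ^ θ ≤ (C * Λ) ^ (1 / (d : ℝ)) * ∏ j, g j p ^ (1 / (d : ℝ)) := by
    intro p hp
    have h1 : T p.1 * (T p.1 ^ θ / Λ) ≤ C * ∏ j, g j p := by
      rw [← hSd p hp]
      exact multijointOperator_mul_le (hs1 p) f
    rw [ENNReal.prod_rpow_of_nonneg (by positivity),
      ← ENNReal.mul_rpow_of_nonneg _ _ (by positivity), one_div,
      ENNReal.le_rpow_inv_iff (by linarith)]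
    have h2 : (T p.1 ^ θ) ^ (d : ℝ) = T p.1 * T p.1 ^ θ := by
      rw [← ENNReal.rpow_mul]
      -- This identity fixes the exponent: `T ^ (θ * d)` is `T` times the test weight, up to `Λ`.
      have : θ * d = 1 + θ := by
        rw [hθdef]; field_simp [show (d : ℝ) - 1 ≠ 0 by linarith]; ring
      rw [this, ENNReal.rpow_add_of_nonneg _ _ zero_le_one hθ.le, ENNReal.rpow_one]
    rw [h2]
    calc _ = (T p.1 * (T p.1 ^ θ / Λ)) * Λ := by
          rw [mul_assoc, ENNReal.div_mul_cancel hΛ0 hΛ]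
      _ ≤ (C * ∏ j, g j p) * Λ := by gcongr
      _ = _ := by ring
  refine le_mul_of_rpow_le hd hΛ0 hΛ (by exact_mod_cast hC) ?_
  calc Λ ≤ ∑ p ∈ A, (C * Λ) ^ (1 / (d : ℝ)) * ∏ j, g j p ^ (1 / (d : ℝ)) :=
        Finset.sum_le_sum hpt
    _ = (C * Λ) ^ (1 / (d : ℝ)) * ∑ p ∈ A, ∏ j, g j p ^ (1 / (d : ℝ)) := by
        exact (Finset.mul_sum _ _ _).symm
    _ ≤ (C * Λ) ^ (1 / (d : ℝ)) * ∏ j, (∑ p ∈ A, g j p) ^ (1 / (d : ℝ)) := by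
        gcongr
        exact ENNReal.sum_prod_rpow_le A hd0 g
    _ ≤ (C * Λ) ^ (1 / (d : ℝ)) * ∏ j, (∑' π : P j, (f j π : ℝ≥0∞)) ^ (1 / (d : ℝ)) := by
        gcongr with j
        exact sum_tsum_le_of_hasSum hs2 f A j
    _ = (C * Λ * B) ^ (1 / (d : ℝ)) := by
        rw [ENNReal.prod_rpow_of_nonneg (by positivity),
          ← ENNReal.mul_rpow_of_nonneg _ _ (by positivity)]

end Inequality

theorem theorem2 (n : ℕ) :
    ∃ C : ℝ≥0, ∀ (𝔽 : Type*) [Field 𝔽] (d : ℕ) (k : Fin d → ℕ),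
      (∀ j, 1 ≤ k j) → ∑ j, k j = n →
      ∀ P : ∀ j, Set (KPlane 𝔽 (k j) n),
        -- the factorisation
        (∀ S : multijoints P → ℝ≥0, (Function.support S).Finite → dNorm d S = 1 →
          ∃ s : ∀ κ : ℕ, multijoints P → Gr 𝔽 κ n → ℝ≥0,
            (∀ (p : multijoints P) (π : ∀ j, KPlane 𝔽 (k j) n), (∀ j, π j ∈ P j) →
              multijointKernel p.1 π * S p ^ d ≤ C * ∏ j, s (k j) p (π j).e) ∧
            (∀ j, ∀ π ∈ P j, (∃ p ∈ multijoints P, p ∈ π.carrier) →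
              HasSum (fun p : {p : multijoints P // p.1 ∈ π.carrier} => s (k j) p.1 π.e) 1)) ∧
        -- the multijoint inequality
        (2 ≤ d → ∀ f : ∀ j, P j → ℝ≥0,
          ∑' p : Fin n → 𝔽, multijointOperator P f p ^ (1 / ((d : ℝ) - 1)) ≤
            (C : ℝ≥0∞) * ∏ j, (∑' π : P j, (f j π : ℝ≥0∞)) ^ (1 / ((d : ℝ) - 1))) := by
  have hC : (1 : ℝ≥0) ≤ 2 * n.factorial := by
    have : 1 ≤ 2 * n.factorial := by have := n.factorial_pos; omega
    exact_mod_cast this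
  refine ⟨2 * n.factorial, fun 𝔽 _ d k _ hk P => ?_⟩
  by_cases hd : d = 0
  -- For `d = 0` the power of `S` and the product are both 1, and the kernel is at most `1 ≤ C`.
  · subst hd
    refine ⟨fun S _ _ => ⟨fun _ _ _ => 0, fun p π _ => ?_, fun j => j.elim0⟩,
      fun h => absurd h (by omega)⟩
    rw [pow_zero, mul_one, Finset.univ_eq_empty, Finset.prod_empty, mul_one]
    exact (multijointKernel_le_one _ _).trans hC
  · have hP := exists_factorisation hd hk P
    exact ⟨hP, fun hd2 f => multijoint_inequality hd2 hC hP f⟩
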